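/- **Setting.** Let $k$ be an algebraically closed field, $K$ a finitely generated extension field of $k$ of transcendence degree $3$, and $R$ a $3$-dimensional regular local ring with maximal ideal $m_R$, with $k\subset R\subset K$, with fraction field $K$, and with regular parameters $x,y,z$. Let $\nu$ be a valuation of $K$, trivial on $k$, of rational rank $1$ (with value group identified with a subgroup of $\mathbb Q$) and zero-dimensional (its residue field is algebraic over $k$, hence equal to $k$), with valuation ring $(V,m_V)$. Assume that $\nu$ dominates $R$, that is, $R\subset V$ and $m_V\cap R=m_R$. Put $\Phi_R=\nu(R\setminus\{0\})$. A family $(Q_j)_{j\in J}$ of elements of $R$ is a *generating sequence* of $\nu$ if for every $\sigma\in\Phi_R$ the ideal $\{f\in R:\nu(f)\ge\sigma\}$ is generated by the finite products $\prod_j Q_j^{b_j}$ ($b_j\in\mathbb Z_{\ge0}$) with $\nu(\prod_jQ_j^{b_j})\ge\sigma$. A monomial in formal variables is *irreducible* with respect to a set $\mathcal X$ of monomials if no monomial dividing it (including itself) belongs to $\mathcal X$. If $\Phi$ is a semigroup generated by $\mu_1,\dots,\mu_r\in\mathbb Q$ and $\mu\in\Phi+(-\Phi)$, a tuple $(a_1,\dots,a_r,a)$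 of nonnegative integers is *reduced* with respect to $(\Phi,\mu)$ if $\sum_j a_j\mu_j+a\mu\in\Phi$ and $\sum_j b_j\mu_j+b\mu\notin\Phi$ for all integers $0\le b_j\le a_j$, $0<b\le a$ with $\sum_j b_j+b<\sum_j a_j+a$. **Jumping polynomials $P_i$ ($i\ge0$).** Put $P_0=x$, $P_1=y$, $\beta_i=\nu(P_i)$, $G_i=\sum_{j=0}^i\beta_j\mathbb Z$, $S_i=\sum_{j=0}^i\beta_j\mathbb Z_{\ge0}$. For $i>0$ let $q_i=\min\{q\in\mathbb Z_{>0}: q\beta_i\in G_{i-1}\}$ and $\mathcal P_i=\{P_j^{q_j}:0<j<i\}$. Choose $n_{i,j}\in\mathbb Z_{\ge0}$ with $q_i\beta_i=\sum_{j=0}^{i-1}n_{i,j}\beta_j$ and $\prod_{j=0}^{i-1}P_j^{n_{i,j}}$ irreducible with respect to $\mathcal P_i$, let $\lambda_i\in k$ be the residue of $P_i^{q_i}/\prod_{j=0}^{i-1}P_j^{n_{i,j}}$ in $V/m_V=k$, and put $P_{i+1}=P_i^{q_i}-\lambda_i\prod_{j=0}^{i-1}P_j^{n_{i,j}}$. Let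 $G=\bigcup_iG_i$, $S=\bigcup_iS_i$, $\mathcal P=\bigcup_i\mathcal P_i$. **Jumping polynomials $T_i$ ($i>0$).** Put $T_1=z$, $m_0=0$, $\delta_0=1$, $\mathcal T_1=\mathcal P$, $H_0=U_0=\{0\}$. For $i>0$ put $\gamma_i=\nu(T_i)$ if $T_i\ne0$ and $\gamma_i=0$ if $T_i=0$; put $H_i=\sum_{j=1}^i\gamma_j\mathbb Z$ and $U_i=\sum_{j=1}^i\gamma_j\mathbb Z_{\ge0}$. If $T_i\ne0$, let $s_i=\min\{s\in\mathbb Z_{>0}: s\gamma_i\in H_{i-1}+G\}$ and $m_i=\max\bigl(m_{i-1},\min\{j\ge0: s_i\gamma_i\in H_{i-1}+G_j\}\bigr)$. Let $\mathcal D_i$ be the set of tuples $\bar d=(a_0,\dots,a_{m_i},c_1,\dots,c_i)$ of nonnegative integers with $c_i>0$ that are reduced with respect to $(S_{m_i}+U_{i-1},\,s_i\gamma_i)$ (the semigroup having generators $\beta_0,\dots,\beta_{m_i},\gamma_1,\dots,\gamma_{i-1}$) and for which $\prod_{j=0}^{m_i}P_j^{a_j}\prod_{j=1}^{i-1}T_j^{c_j}$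 is irreducible with respect to $\mathcal T_i$. Put $\delta_i=\#\mathcal D_i$, write $M_{\bar d}=T_i^{c_is_i}\prod_{j=0}^{m_i}P_j^{a_j}\prod_{j=1}^{i-1}T_j^{c_j}$ and $|\bar d|=\sum_{j=0}^{m_i}a_j\beta_j+\sum_{j=1}^{i-1}c_j\gamma_j+c_is_i\gamma_i$, and put $\mathcal T_{i+1}=\mathcal T_i\cup\{M_{\bar d}:\bar d\in\mathcal D_i\}$. Order $\mathcal D_i=\{\bar d_1,\dots,\bar d_{\delta_i}\}$ so that $|\bar d_1|\le\dots\le|\bar d_{\delta_i}|$. For $1\le t\le\delta_i$ and $\bar d=\bar d_t$, choose a monomial $N_{\bar d}=\prod_{j=0}^{m_i}P_j^{n_j}\prod_{j=1}^{i-1}T_j^{l_j}$, irreducible with respect to $\mathcal T_i$, with $|\bar d|=\sum_{j=0}^{m_i} n_j\beta_j+\sum_{j=1}^{i-1} l_j\gamma_j$, let $\mu_{\bar d}\in k$ be the residue of $M_{\bar d}/N_{\bar d}$ in $V/m_V=k$, and put $$T_{\delta_0+\dots+\delta_{i-1}+t}=M_{\bar d}-\mu_{\bar d}N_{\bar d}.$$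 If $T_i=0$, put $m_i=m_{i-1}$, $\mathcal D_i=\emptyset$, $\delta_i=0$, $\mathcal T_{i+1}=\mathcal T_i\cup\{T_i\}$. Should the family stop, that is, should some $j>0$ satisfy $\delta_0+\dots+\delta_{j-1}<j$, it is continued by $T_j=0$. Let $U=\bigcup_iU_i$. **Theorem.** This construction can be carried out (in particular all $\mathcal D_i$ are finite). For every choice made in it, the family $\{P_i\}_{i\ge0}\cup\{T_i\}_{i>0}$ is a generating sequence of $\nu$ in $R$. Moreover $\Phi_R=S+U$, so that the values $\{\beta_i\}_{i\ge0}\cup\{\gamma_i\}_{i>0}$ generate $\Phi_R$ as a semigroup (with $0$). -/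

import Mathlib

namespace JumpingPolynomials

noncomputable section

/-! ### Arithmetic and monomials

`β : ℕ → ℚ` stands for the values of `P₀, P₁, P₂, …` and `γ : ℕ → ℚ` for the values of
`T₁, T₂, …` (the index `0` of `γ` and of `T` is never used).  A formal monomial in the variables
`P₀, P₁, …, T₁, T₂, …` is an exponent vector `ℕ ⊕ ℕ →₀ ℕ`, where the variable `P_j` is `Sum.inl j`
and the variable `T_j` is `Sum.inr j`. -/

/-- Formal monomials in the variables `P_j` (`Sum.inl j`) and `T_j` (`Sum.inr j`). -/
abbrev Mon : Type := ℕ ⊕ ℕ →₀ ℕ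

/-- `G_i = ∑_{j=0}^{i} β_j ℤ`. -/
def G (β : ℕ → ℚ) (i : ℕ) : AddSubgroup ℚ := AddSubgroup.closure (β '' {j | j ≤ i})

/-- `S_i = ∑_{j=0}^{i} β_j ℤ_{≥ 0}`. -/
def S (β : ℕ → ℚ) (i : ℕ) : AddSubmonoid ℚ := AddSubmonoid.closure (β '' {j | j ≤ i})

/-- `H_i = ∑_{j=1}^{i} γ_j ℤ`. -/
def H (γ : ℕ → ℚ) (i : ℕ) : AddSubgroup ℚ := AddSubgroup.closure (γ '' {j | 1 ≤ j ∧ j ≤ i})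

/-- `U_i = ∑_{j=1}^{i} γ_j ℤ_{≥ 0}`. -/
def U (γ : ℕ → ℚ) (i : ℕ) : AddSubmonoid ℚ := AddSubmonoid.closure (γ '' {j | 1 ≤ j ∧ j ≤ i})

/-- `q_i = min {q > 0 | q β_i ∈ G_{i-1}}`, for `i > 0`. -/
def q (β : ℕ → ℚ) (i : ℕ) : ℕ := sInf {n : ℕ | 0 < n ∧ n • β i ∈ G β (i - 1)}

/-- `s_i = min {s > 0 | s γ_i ∈ H_{i-1} + G}` with `G = ⋃_j G_j`, for `i > 0`.
If `γ_i = 0`, this is `1`. -/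
def s (β γ : ℕ → ℚ) (i : ℕ) : ℕ := sInf {n : ℕ | 0 < n ∧ n • γ i ∈ H γ (i - 1) ⊔ ⨆ j, G β j}

/-- `m_0 = 0` and `m_i = max (m_{i-1}, min {j | s_i γ_i ∈ H_{i-1} + G_j})` for `i > 0`.
If `γ_i = 0`, this is `m_{i-1}`. -/
def m (β γ : ℕ → ℚ) : ℕ → ℕ
  | 0 => 0
  | i + 1 => max (m β γ i) (sInf {j : ℕ | s β γ (i + 1) • γ (i + 1) ∈ H γ i ⊔ G β j})

/-- The value `∑_j a_j w_j` of an exponent vector `a` with respect to the weights `w`. -/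
def weight {ι : Type*} (w : ι → ℚ) (a : ι →₀ ℕ) : ℚ := a.sum fun v n => n • w v

/-- `M` is irreducible with respect to the set `X` of monomials: no monomial
dividing `M` belongs to `X`. -/
def Irred (X : Set Mon) (M : Mon) : Prop := ∀ b ≤ M, b ∉ X

/-- `(a, c)` is reduced with respect to `(Φ, μ)`, where `Φ` is generated by the `w_v`:
`∑ a_v w_v + c μ ∈ Φ`, and `∑ b_v w_v + e μ ∉ Φ` whenever `0 ≤ b_v ≤ a_v`, `0 < e ≤ c` and
`∑ b_v + e < ∑ a_v + c`. -/
def IsReduced {ι : Type*} (Φ : AddSubmonoid ℚ) (w : ι → ℚ) (μ : ℚ) (a : ι →₀ ℕ) (c : ℕ) : Prop :=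
  weight w a + c • μ ∈ Φ ∧
    ∀ b ≤ a, ∀ e : ℕ, 0 < e → e ≤ c →
      (b.sum fun _ n => n) + e < (a.sum fun _ n => n) + c → weight w b + e • μ ∉ Φ

/-- The variables `P_0, …, P_k, T_1, …, T_i`. -/
def vars (k i : ℕ) : Set (ℕ ⊕ ℕ) := Sum.inl '' {j | j ≤ k} ∪ Sum.inr '' {j | 1 ≤ j ∧ j ≤ i}

/-- `𝒫_i = {P_j^{q_j} | 0 < j < i}`. -/
def PP (β : ℕ → ℚ) (i : ℕ) : Set Mon :=
  {M | ∃ j, 0 < j ∧ j < i ∧ M = Finsupp.single (Sum.inl j) (q β j)}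

/-- Given the set of monomials `X = 𝒯_i`, the set `𝒟_i` of all `(a, c_i)`, where `a` collects the
exponents `a_0, …, a_{m_i}` of `P_0, …, P_{m_i}` and `c_1, …, c_{i-1}` of `T_1, …, T_{i-1}`,
such that `c_i > 0`, the tuple is reduced with respect to `(S_{m_i} + U_{i-1}, s_i γ_i)`, and the
monomial `a` is irreducible with respect to `X`. -/
def DD (β γ : ℕ → ℚ) (i : ℕ) (X : Set Mon) : Set (Mon × ℕ) :=
  {d | (∀ v ∈ d.1.support, v ∈ vars (m β γ i) (i - 1)) ∧ 0 < d.2 ∧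
    IsReduced (S β (m β γ i) ⊔ U γ (i - 1)) (Sum.elim β γ) (s β γ i • γ i) d.1 d.2 ∧ Irred X d.1}

/-- The monomial `T_i^{c_i s_i} ∏ P_j^{a_j} ∏_{j<i} T_j^{c_j}` attached to `d ∈ 𝒟_i`. -/
def lead (β γ : ℕ → ℚ) (i : ℕ) (d : Mon × ℕ) : Mon :=
  d.1 + Finsupp.single (Sum.inr i) (d.2 * s β γ i)

open Classical in
/-- The sets `𝒯_i`, where `Z` is the set of all `i` with `T_i = 0`: `𝒯_1 = 𝒫 = ⋃_i 𝒫_i`, and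
for `i > 0` the set `𝒯_{i+1}` is `𝒯_i ∪ {T_i}` if `T_i = 0`, and the union of `𝒯_i` with the
monomials `lead d`, `d ∈ 𝒟_i`, if `T_i ≠ 0`. (The value `𝒯_0 = 𝒫` is not used.) -/
def TT (β γ : ℕ → ℚ) (Z : Set ℕ) : ℕ → Set Mon
  | 0 => ⋃ i, PP β i
  | 1 => ⋃ i, PP β i
  | i + 2 => TT β γ Z (i + 1) ∪
      if i + 1 ∈ Z then {Finsupp.single (Sum.inr (i + 1)) 1}
      else lead β γ (i + 1) '' DD β γ (i + 1) (TT β γ Z (i + 1))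

open Classical in
/-- The index set `𝒟_i`, for `i > 0`, which is empty if `T_i = 0`. -/
def D (β γ : ℕ → ℚ) (Z : Set ℕ) (i : ℕ) : Set (Mon × ℕ) :=
  if i ∈ Z then ∅ else DD β γ i (TT β γ Z i)

/-- `δ_0 = 1`, and `δ_i = #𝒟_i` for `i > 0`. -/
def δ (β γ : ℕ → ℚ) (Z : Set ℕ) (i : ℕ) : ℕ := if i = 0 then 1 else (D β γ Z i).ncard

/-! ### Valuations and jumping polynomials -/

section Valuation

variable {k R K : Type*} [Field k] [CommRing R] [Field K] [Algebra k R] [Algebra R K] [Algebra k K]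

/-- The `k`-valuation `ν` is zero-dimensional: its residue field is algebraic over `k`, that is,
every `f` in the valuation ring is congruent modulo the maximal ideal of the valuation ring
to a root of a nonzero polynomial with coefficients in `k`. -/
def IsZeroDimensional (k : Type*) {K : Type*} [Field k] [Field K] [Algebra k K]
    (ν : AddValuation K (WithTop ℚ)) : Prop :=
  ∀ f : K, 0 ≤ ν f → ∃ p : Polynomial k, p ≠ 0 ∧ 0 < ν (Polynomial.aeval f p)

/-- `R` is dominated by `ν`: `R` is contained in the valuation ring `V`, and `m_R = m_V ∩ R`. -/
def Dominates (ν : AddValuation K (WithTop ℚ)) (R : Type*) [CommRing R] [IsLocalRing R]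
    [Algebra R K] : Prop :=
  ∀ f : R, 0 ≤ ν (algebraMap R K f) ∧
    (f ∈ IsLocalRing.maximalIdeal R ↔ 0 < ν (algebraMap R K f))

/-- The value semigroup `Φ_R = ν(R ∖ {0})`. -/
def valueSemigroup (ν : AddValuation K (WithTop ℚ)) (R : Type*) [CommRing R] [Algebra R K] :
    Set ℚ :=
  {a | ∃ f : R, f ≠ 0 ∧ ν (algebraMap R K f) = (a : WithTop ℚ)}

/-- The rational number `ν(f)` for `f ≠ 0`, and `0` for `f = 0`. -/
def val (ν : AddValuation K (WithTop ℚ)) (f : R) : ℚ := (ν (algebraMap R K f)).untopD 0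

/-- The element `∏_v Q_v^{b_v}`. -/
def evalMon {ι : Type*} (Q : ι → R) (b : ι →₀ ℕ) : R := b.prod fun v n => Q v ^ n

/-- The family `Q` of elements of `R` is a generating sequence of `ν`: for all `σ ∈ Φ_R`, the ideal
`I_σ = {f ∈ R | ν(f) ≥ σ}` is generated by the products of powers of members of the family that
have value at least `σ`. -/
def IsGeneratingSequence (ν : AddValuation K (WithTop ℚ)) {ι : Type*} (Q : ι → R) : Prop :=
  ∀ σ ∈ valueSemigroup ν R,
    (Ideal.span {g : R | ∃ b : ι →₀ ℕ, g = evalMon Q b ∧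
        (σ : WithTop ℚ) ≤ ν (algebraMap R K (evalMon Q b))} : Set R) =
      {f : R | (σ : WithTop ℚ) ≤ ν (algebraMap R K f)}

/-- `c ∈ k` is the residue of `f / g` in `V / m_V`. -/
def IsResidue (ν : AddValuation K (WithTop ℚ)) (f g : R) (c : k) : Prop :=
  0 < ν (algebraMap R K f / algebraMap R K g - algebraMap k K c)

/-- The sequences `P_0, P_1, …` and `T_1, T_2, …` are obtained by the recursive construction
of jumping polynomials from the regular parameters `x, y, z`.  `T 0` plays no role.
The construction puts the successors of `T_i` in the positions `δ_0 + … + δ_{i-1} + 1, …,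
δ_0 + … + δ_i`. Should no element be assigned to the position `j` (that is, should all
of `T_1, …, T_{j-1}` have been treated and produced fewer than `j` elements), we put `T_j = 0`,
so that a family that stops is continued by zeros. -/
structure IsJumpingSequence (k : Type*) {R K : Type*} [Field k] [CommRing R] [Field K]
    [Algebra k R] [Algebra R K] [Algebra k K] (ν : AddValuation K (WithTop ℚ)) (x y z : R)
    (P T : ℕ → R) (β γ : ℕ → ℚ) (Z : Set ℕ) : Prop where
  /-- `β_i = ν(P_i)`. -/
  beta_eq : ∀ i, β i = val ν (P i)
  /-- `γ_i = ν(T_i)` if `T_i ≠ 0`, and `γ_i = 0` if `T_i = 0`. -/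
  gamma_eq : ∀ i, γ i = val ν (T i)
  /-- `Z` is the set of all `i` with `T_i = 0`. -/
  zero_iff : ∀ i, i ∈ Z ↔ T i = 0
  P_zero : P 0 = x
  P_one : P 1 = y
  /-- `P_{i+1} = P_i^{q_i} - λ_i ∏_{j<i} P_j^{n_{i,j}}`. -/
  P_succ : ∀ i, 0 < i → ∃ (n : Mon) (lam : k),
    (∀ v ∈ n.support, v ∈ Sum.inl '' {j | j < i}) ∧
    q β i • β i = weight (Sum.elim β γ) n ∧
    Irred (PP β i) n ∧
    IsResidue ν (P i ^ q β i) (evalMon (Sum.elim P T) n) lam ∧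
    P (i + 1) = P i ^ q β i - algebraMap k R lam * evalMon (Sum.elim P T) n
  T_one : T 1 = z
  /-- If `T_i ≠ 0`, then `𝒟_i = {d_1, …, d_{δ_i}}` with `|d_1| ≤ … ≤ |d_{δ_i}|` (here `e t` is
  `d_{t+1}`), and `T_{δ_0 + … + δ_{i-1} + t} = T_{d_t}` for `1 ≤ t ≤ δ_i`. -/
  T_succ : ∀ i, 0 < i → T i ≠ 0 → ∃ e : Fin (δ β γ Z i) ≃ D β γ Z i,
    (Monotone fun t => weight (Sum.elim β γ) (lead β γ i (e t))) ∧
    ∀ t, ∃ (n : Mon) (mu : k),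
      (∀ v ∈ n.support, v ∈ vars (m β γ i) (i - 1)) ∧
      weight (Sum.elim β γ) (lead β γ i (e t)) = weight (Sum.elim β γ) n ∧
      Irred (TT β γ Z i) n ∧
      IsResidue ν (evalMon (Sum.elim P T) (lead β γ i (e t))) (evalMon (Sum.elim P T) n) mu ∧
      T ((∑ j ∈ Finset.range i, δ β γ Z j) + (t + 1)) =
        evalMon (Sum.elim P T) (lead β γ i (e t)) -
          algebraMap k R mu * evalMon (Sum.elim P T) n
  T_rest : ∀ j, 0 < j → (∑ l ∈ Finset.range j, δ β γ Z l) < j → T j = 0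

end Valuation

end

end JumpingPolynomials

/-!
The construction is driven by two facts about the monomials in the `P_j` and `T_j` that are
irreducible with respect to `⋃ 𝒯_i`.

* Irreducible monomials have distinct values (`eq_of_weight_eq`). Cancel the common variables of two
  irreducible monomials of the same value and let `T_i` be the last `T` that is left, in one of them.
  Because of `(H_i + G_l) ∩ G = G_l` for `l ≥ m_i` (`mem_G_of_mem_H_sup_G`) and the minimality of
  the `q_j`, no `P_j` with `j > m_i` is left. Hence the exponent of `T_i` is `c s_i`, and the
  remaining exponents together with `c` form a tuple whose value lies in `S_{m_i} + U_{i-1}`.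
  A minimal tuple below it is reduced, so an element of `𝒯_{i+1}` divides the monomial.
* A product of jumping polynomials that is not irreducible can be rewritten
  (`IsJumpingSequence.exists_reduction`): an element of `𝒯_i` is a constant multiple of
  a monomial of the same value in smaller variables plus a later jumping polynomial, whose value
  is larger. The first term decreases in the lexicographic order, which is a well-order; the second
  one increases the value, and bounded increasing sequences of values are finite since `R` modulo
  a power of its maximal ideal has finite length (`wellFounded_values`).

Let `J_σ` be the ideal generated by the monomials of value at least `σ`. It contains a power of the
maximal ideal, and the residue field is `k`, so rewriting shows that every element of `R` is
congruent modulo `J_σ` to a linear combination of irreducible monomials of values less than `σ`.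
As these values are distinct, an element of value at least `σ` lies in `J_σ`
(`IsJumpingSequence.monomialIdeal_eq`). The assertion on `Φ_R` follows formally
(`valueSemigroup_eq_closure`).

The construction never gets stuck (`exists_isJumpingSequence`): the sets `𝒟_i` are antichains of
exponent vectors, hence finite by Dickson's lemma (`DD_finite`); the required irreducible monomials
are the lexicographically smallest ones of the given value (`exists_irred`), where `q_i β_i ∈ S_{i-1}`
is a consequence of `β_{j+1} > q_j β_j`; and the `P_i` do not vanish because modulo `x` they are
powers of `y`, which are nonzero by Krull's height theorem (`P_properties`, `not_dvd_pow`).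
-/

namespace JumpingPolynomials

open Finsupp (single)

/-! ### Weights and supports of formal monomials -/

section Weight

variable {ι : Type*} (w : ι → ℚ)

theorem weight_zero : weight w 0 = 0 := Finsupp.sum_zero_index

theorem weight_add (a b : ι →₀ ℕ) : weight w (a + b) = weight w a + weight w b :=
  Finsupp.sum_add_index' (fun _ => zero_nsmul _) fun _ _ _ => add_nsmul _ _ _

theorem weight_single (v : ι) (n : ℕ) : weight w (single v n) = n • w v :=
  Finsupp.sum_single_index (zero_nsmul _)

theorem weight_sub_add {a b : ι →₀ ℕ} (h : b ≤ a) :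
    weight w (a - b) + weight w b = weight w a := by
  rw [← weight_add, tsub_add_cancel_of_le h]

theorem weight_congr {w w' : ι → ℚ} {a : ι →₀ ℕ} (h : ∀ v ∈ a.support, w v = w' v) :
    weight w a = weight w' a :=
  Finsupp.sum_congr fun v hv => by rw [h v hv]

theorem weight_mem {A : Type*} [SetLike A ℚ] [AddSubmonoidClass A ℚ] (Φ : A) {a : ι →₀ ℕ}
    (h : ∀ v ∈ a.support, w v ∈ Φ) : weight w a ∈ Φ :=
  sum_mem fun v hv => nsmul_mem (h v hv) _

theorem support_subset_of_le {a b : ι →₀ ℕ} (h : b ≤ a) {p : ι → Prop}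
    (ha : ∀ v ∈ a.support, p v) : ∀ v ∈ b.support, p v := fun v hv =>
  ha v (Finsupp.support_mono h hv)

theorem support_add_subset {a b : ι →₀ ℕ} {p : ι → Prop}
    (ha : ∀ v ∈ a.support, p v) (hb : ∀ v ∈ b.support, p v) : ∀ v ∈ (a + b).support, p v := by
  classical
  intro v hv
  rcases Finset.mem_union.1 (Finsupp.support_add hv) with h | h
  exacts [ha v h, hb v h]

theorem support_single_subset {v : ι} {n : ℕ} {p : ι → Prop} (h : p v) :
    ∀ u ∈ (single v n).support, p u := fun u hu => by
  rwa [Finset.mem_singleton.1 (Finsupp.support_single_subset hu)]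

/-- The semigroup generated by the values of the variables in `V` consists of the values of the
monomials in these variables. -/
theorem exists_weight_eq {V : Set ι} {g : ℚ} (hg : g ∈ AddSubmonoid.closure (w '' V)) :
    ∃ a : ι →₀ ℕ, (∀ v ∈ a.support, v ∈ V) ∧ weight w a = g := by
  induction hg using AddSubmonoid.closure_induction with
  | mem x hx =>
    obtain ⟨v, hv, rfl⟩ := hx
    exact ⟨single v 1, support_single_subset hv, by rw [weight_single, one_nsmul]⟩
  | zero => exact ⟨0, by simp, weight_zero w⟩
  | add x y _ _ hx hy =>
    obtain ⟨a, ha, rfl⟩ := hx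
    obtain ⟨b, hb, rfl⟩ := hy
    exact ⟨a + b, support_add_subset ha hb, weight_add w a b⟩

end Weight

theorem Irred.mono_set {X Y : Set Mon} (h : X ⊆ Y) {M : Mon} (hM : Irred Y M) : Irred X M :=
  fun b hb hbX => hM b hb (h hbX)

theorem Irred.of_le {X : Set Mon} {M N : Mon} (h : N ≤ M) (hM : Irred X M) : Irred X N :=
  fun b hb => hM b (hb.trans h)

/-! ### The order of the variables and rewriting of monomials -/

/-- The order `P_0 < P_1 < … < T_1 < T_2 < …` of the variables. -/
abbrev VarLT : ℕ ⊕ ℕ → ℕ ⊕ ℕ → Prop := Sum.Lex (· < ·) (· < ·)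

/-- The lexicographic order of monomials in which the largest variable dominates. -/
def MonLT : Mon → Mon → Prop := Finsupp.Lex (Function.swap VarLT) (· < ·)

theorem wellFounded_monLT : WellFounded MonLT := by
  refine Finsupp.Lex.wellFounded' (fun n => Nat.not_lt_zero n) wellFounded_lt ?_
  exact Sum.lex_wf wellFounded_lt wellFounded_lt

/-- Replacing a divisor `b` of `M` by a monomial in variables that are smaller than the largest
variable of `b` makes `M` smaller. -/
theorem monLT_replace {M b N : Mon} (hb : b ≤ M) {v : ℕ ⊕ ℕ} (hv : 0 < b v)
    (hbv : ∀ u, VarLT v u → b u = 0) (hN : ∀ u ∈ N.support, VarLT u v) : MonLT (M - b + N) M := by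
  have hN0 : ∀ u, ¬ VarLT u v → N u = 0 := fun u hu => by
    by_contra h
    exact hu (hN u (Finsupp.mem_support_iff.2 h))
  refine ⟨v, fun u hu => ?_, ?_⟩
  · have hu' : VarLT v u := hu
    have : N u = 0 := hN0 u fun h => asymm_of VarLT h hu'
    simp [hbv u hu', this]
  · have h1 : N v = 0 := hN0 v (irrefl_of VarLT v)
    have h2 := hb v
    simp only [Finsupp.coe_add, Finsupp.coe_tsub, Pi.add_apply, Pi.sub_apply, h1]
    omega

/-- `v` is the largest variable of `b`, and `N` is a monomial of the same value as `b` in the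
variables smaller than `v`. -/
structure IsRewriting (w : ℕ ⊕ ℕ → ℚ) (b : Mon) (v : ℕ ⊕ ℕ) (N : Mon) : Prop where
  pos : 0 < b v
  eq_zero : ∀ u, VarLT v u → b u = 0
  lt : ∀ u ∈ N.support, VarLT u v
  weight_eq : weight w N = weight w b

/-- If each monomial of `X` in the variables `V` can be rewritten in terms of smaller variables
from `V`, then every value of a monomial in `V` is the value of an irreducible one: take the
lexicographically smallest one. -/
theorem exists_irred (w : ℕ ⊕ ℕ → ℚ) (X : Set Mon) (V : Set (ℕ ⊕ ℕ))
    (hX : ∀ b ∈ X, (∀ v ∈ b.support, v ∈ V) → ∃ v N, IsRewriting w b v N ∧ ∀ u ∈ N.support, u ∈ V)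
    (M : Mon) (hM : ∀ v ∈ M.support, v ∈ V) :
    ∃ N : Mon, (∀ v ∈ N.support, v ∈ V) ∧ weight w N = weight w M ∧ Irred X N := by
  obtain ⟨N, ⟨hNV, hNw⟩, hmin⟩ := wellFounded_monLT.has_min
    {N : Mon | (∀ v ∈ N.support, v ∈ V) ∧ weight w N = weight w M} ⟨M, hM, rfl⟩
  refine ⟨N, hNV, hNw, fun b hb hbX => ?_⟩
  obtain ⟨v, N', hr, hN'⟩ := hX b hbX (support_subset_of_le hb hNV)
  refine hmin (N - b + N') ⟨support_add_subset (support_subset_of_le tsub_le_self hNV) hN', ?_⟩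
    (monLT_replace hb hr.pos hr.eq_zero hr.lt)
  rw [weight_add, hr.weight_eq, weight_sub_add w hb, hNw]

/-! ### Groups and semigroups of values -/

section Arith

variable (β γ : ℕ → ℚ)

theorem G_mono {i j : ℕ} (h : i ≤ j) : G β i ≤ G β j :=
  AddSubgroup.closure_mono (Set.image_mono fun _ hl => le_trans hl h)

theorem G_le_iSup (i : ℕ) : G β i ≤ ⨆ j, G β j := le_iSup (G β) i

theorem S_mono {i j : ℕ} (h : i ≤ j) : S β i ≤ S β j :=
  AddSubmonoid.closure_mono (Set.image_mono fun _ hl => le_trans hl h)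

theorem mem_G {i j : ℕ} (h : j ≤ i) : β j ∈ G β i := AddSubgroup.subset_closure ⟨j, h, rfl⟩

theorem mem_S {i j : ℕ} (h : j ≤ i) : β j ∈ S β i := AddSubmonoid.subset_closure ⟨j, h, rfl⟩

theorem mem_H {i j : ℕ} (hj : 1 ≤ j) (h : j ≤ i) : γ j ∈ H γ i :=
  AddSubgroup.subset_closure ⟨j, ⟨hj, h⟩, rfl⟩

theorem mem_U {i j : ℕ} (hj : 1 ≤ j) (h : j ≤ i) : γ j ∈ U γ i :=
  AddSubmonoid.subset_closure ⟨j, ⟨hj, h⟩, rfl⟩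

theorem mem_iSup_G {g : ℚ} : g ∈ ⨆ j, G β j ↔ ∃ j, g ∈ G β j :=
  AddSubgroup.mem_iSup_of_directed (monotone_nat_of_le_succ fun n => G_mono β n.le_succ).directed_le

theorem G_succ (i : ℕ) : G β (i + 1) = G β i ⊔ AddSubgroup.zmultiples (β (i + 1)) := by
  rw [G, G, AddSubgroup.zmultiples_eq_closure, ← AddSubgroup.closure_union,
    ← Set.image_singleton, ← Set.image_union]
  congr 2
  ext j
  simp only [Set.mem_ofPred_eq, Set.mem_union, Set.mem_singleton_iff]
  omega

theorem H_zero : H γ 0 = ⊥ := by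
  rw [H, show {j : ℕ | 1 ≤ j ∧ j ≤ 0} = ∅ by ext j; simp; omega]
  simp

theorem H_succ (i : ℕ) : H γ (i + 1) = H γ i ⊔ AddSubgroup.zmultiples (γ (i + 1)) := by
  rw [H, H, AddSubgroup.zmultiples_eq_closure, ← AddSubgroup.closure_union,
    ← Set.image_singleton, ← Set.image_union]
  congr 2
  ext j
  simp only [Set.mem_ofPred_eq, Set.mem_union, Set.mem_singleton_iff]
  omega

theorem S_sup_U (k i : ℕ) :
    S β k ⊔ U γ i = AddSubmonoid.closure (Sum.elim β γ '' vars k i) := by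
  rw [vars, Set.image_union, Set.image_image, Set.image_image, AddSubmonoid.closure_union]
  rfl

theorem weight_mem_S_sup_U {k i : ℕ} {a : Mon} (ha : ∀ v ∈ a.support, v ∈ vars k i) :
    weight (Sum.elim β γ) a ∈ S β k ⊔ U γ i := by
  rw [S_sup_U]
  exact weight_mem _ _ fun v hv => AddSubmonoid.subset_closure ⟨v, ha v hv, rfl⟩

theorem elim_mem_H_sup_G {k i : ℕ} {v : ℕ ⊕ ℕ} (hv : v ∈ vars k i) :
    Sum.elim β γ v ∈ H γ i ⊔ G β k := by
  rcases hv with ⟨j, hj, rfl⟩ | ⟨j, hj, rfl⟩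
  · exact AddSubgroup.mem_sup_right (mem_G β hj)
  · exact AddSubgroup.mem_sup_left (mem_H γ hj.1 hj.2)

theorem weight_mem_H_sup_G {k i : ℕ} {a : Mon} (ha : ∀ v ∈ a.support, v ∈ vars k i) :
    weight (Sum.elim β γ) a ∈ H γ i ⊔ G β k :=
  weight_mem _ _ fun v hv => elim_mem_H_sup_G β γ (ha v hv)

theorem vars_mono {k k' i i' : ℕ} (hk : k ≤ k') (hi : i ≤ i') : vars k i ⊆ vars k' i' :=
  Set.union_subset_union (Set.image_mono fun _ h => le_trans h hk)
    (Set.image_mono fun _ h => ⟨h.1, h.2.trans hi⟩)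

theorem inl_mem_vars {k i j : ℕ} : Sum.inl j ∈ vars k i ↔ j ≤ k := by
  simp [vars]

theorem inr_mem_vars {k i j : ℕ} : Sum.inr j ∈ vars k i ↔ 1 ≤ j ∧ j ≤ i := by
  simp [vars]

variable {β}

theorem exists_nsmul_mem_G (h0 : β 0 ≠ 0) (g : ℚ) (i : ℕ) : ∃ n : ℕ, 0 < n ∧ n • g ∈ G β i := by
  refine ⟨(g / β 0).den, (g / β 0).den_pos, ?_⟩
  have : (g / β 0).den • g = (g / β 0).num • β 0 := by
    have h := Rat.mul_den_eq_num (g / β 0)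
    rw [nsmul_eq_mul, zsmul_eq_mul, ← h]
    field_simp
  rw [this]
  exact zsmul_mem (mem_G β (Nat.zero_le i)) _

theorem q_spec (h0 : β 0 ≠ 0) (i : ℕ) : 0 < q β i ∧ q β i • β i ∈ G β (i - 1) :=
  Nat.sInf_mem (exists_nsmul_mem_G h0 (β i) (i - 1))

theorem q_le {i n : ℕ} (hn : 0 < n) (h : n • β i ∈ G β (i - 1)) : q β i ≤ n := Nat.sInf_le ⟨hn, h⟩

theorem s_spec (h0 : β 0 ≠ 0) (i : ℕ) :
    0 < s β γ i ∧ s β γ i • γ i ∈ H γ (i - 1) ⊔ ⨆ j, G β j := by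
  obtain ⟨n, hn, h⟩ := exists_nsmul_mem_G h0 (γ i) 0
  exact Nat.sInf_mem (s := {n : ℕ | 0 < n ∧ n • γ i ∈ H γ (i - 1) ⊔ ⨆ j, G β j})
    ⟨n, hn, AddSubgroup.mem_sup_right (G_le_iSup β 0 h)⟩

/-- A minimal positive multiple in a subgroup divides all multiples in the subgroup. -/
theorem dvd_of_zsmul_mem {A : AddSubgroup ℚ} {g : ℚ} {n : ℕ} (hn : 0 < n) (hA : n • g ∈ A)
    (hmin : ∀ l : ℕ, 0 < l → l • g ∈ A → n ≤ l) {z : ℤ} (hz : z • g ∈ A) : (n : ℤ) ∣ z := by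
  rw [Int.dvd_iff_emod_eq_zero]
  by_contra hne
  have hpos : (0 : ℤ) < n := by exact_mod_cast hn
  have h1 := Int.emod_nonneg z hpos.ne'
  have h2 := Int.emod_lt_of_pos z hpos
  have h3 : (z % n) • g ∈ A := by
    have : (z % n) • g = z • g - (z / n) • (n • g) := by
      have h : z % n = z - n * (z / n) := by
        have := Int.emod_add_mul_ediv z n
        linarith
      simp only [h, zsmul_eq_mul, nsmul_eq_mul]
      push_cast
      ring
    rw [this]
    exact sub_mem hz (zsmul_mem hA _)
  obtain ⟨l, hl⟩ := Int.eq_ofNat_of_zero_le h1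
  rw [hl] at h3 hne h2
  rw [natCast_zsmul] at h3
  have := hmin l (by omega) h3
  omega

theorem s_dvd (h0 : β 0 ≠ 0) {i : ℕ} {z : ℤ} (hz : z • γ i ∈ H γ (i - 1) ⊔ ⨆ j, G β j) :
    (s β γ i : ℤ) ∣ z :=
  dvd_of_zsmul_mem (s_spec γ h0 i).1 (s_spec γ h0 i).2 (fun _ hl h => Nat.sInf_le ⟨hl, h⟩) hz

theorem m_mono : Monotone (m β γ) := monotone_nat_of_le_succ fun _ => le_max_left _ _

theorem s_smul_mem (h0 : β 0 ≠ 0) (i : ℕ) :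
    s β γ (i + 1) • γ (i + 1) ∈ H γ i ⊔ G β (m β γ (i + 1)) := by
  have hne : {j : ℕ | s β γ (i + 1) • γ (i + 1) ∈ H γ i ⊔ G β j}.Nonempty := by
    obtain ⟨h, hh, g, hg, hs⟩ := AddSubgroup.mem_sup.1 (s_spec γ h0 (i + 1)).2
    obtain ⟨j, hj⟩ := (mem_iSup_G β).1 hg
    exact ⟨j, AddSubgroup.mem_sup.2 ⟨h, hh, g, hj, hs⟩⟩
  exact sup_le_sup_left (G_mono β (le_max_right _ _)) _ (Nat.sInf_mem hne)

/-- `(H_i + G_k) ∩ G = G_k` for `k ≥ m_i`: although the values of `T_1, …, T_i` may lie in `G`, they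
produce no new elements of `G` beyond `G_{m_i}`. -/
theorem mem_G_of_mem_H_sup_G (h0 : β 0 ≠ 0) (i : ℕ) : ∀ {k : ℕ} {g : ℚ}, m β γ i ≤ k →
    g ∈ H γ i ⊔ G β k → g ∈ ⨆ j, G β j → g ∈ G β k := by
  induction i with
  | zero =>
    intro k g _ hg _
    rwa [H_zero, bot_sup_eq] at hg
  | succ i ih =>
    intro k g hk hg hgG
    refine ih ((m_mono γ i.le_succ).trans hk) ?_ hgG
    rw [H_succ, sup_right_comm] at hg
    obtain ⟨g', hg', t, ht, rfl⟩ := AddSubgroup.mem_sup.1 hg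
    obtain ⟨z, rfl⟩ := AddSubgroup.mem_zmultiples_iff.1 ht
    have hz : z • γ (i + 1) ∈ H γ i ⊔ ⨆ j, G β j := by
      have h1 : g' ∈ H γ i ⊔ ⨆ j, G β j := sup_le_sup_left (G_le_iSup β k) (H γ i) hg'
      have hle : (⨆ j, G β j) ≤ H γ i ⊔ ⨆ j, G β j := le_sup_right
      have h2 := hle hgG
      have h3 := sub_mem h2 h1
      rwa [add_sub_cancel_left] at h3
    obtain ⟨c, rfl⟩ := s_dvd γ h0 (i := i + 1) hz
    refine add_mem hg' ?_
    rw [mul_zsmul', natCast_zsmul]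
    exact zsmul_mem (sup_le_sup_left (G_mono β hk) _ (s_smul_mem γ h0 i)) _

end Arith

/-! ### Values of the polynomials `P_i` -/

section PValues

variable {β : ℕ → ℚ}

/-- Division with remainder in `G_i`: modulo `G_{i-1}`, an element of `G_i` is `r β_i` with
`0 ≤ r < q_i`. -/
theorem exists_sub_nsmul_mem_G (h0 : β 0 ≠ 0) (i : ℕ) {g : ℚ} (hg : g ∈ G β (i + 1)) :
    ∃ r : ℕ, r + 1 ≤ q β (i + 1) ∧ g - r • β (i + 1) ∈ G β i := by
  obtain ⟨hq, hqG⟩ := q_spec h0 (i + 1)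
  rw [G_succ] at hg
  obtain ⟨g', hg', t, ht, rfl⟩ := AddSubgroup.mem_sup.1 hg
  obtain ⟨z, rfl⟩ := AddSubgroup.mem_zmultiples_iff.1 ht
  have hpos : (0 : ℤ) < q β (i + 1) := by exact_mod_cast hq
  obtain ⟨r, hr⟩ := Int.eq_ofNat_of_zero_le (Int.emod_nonneg z hpos.ne')
  have hlt := Int.emod_lt_of_pos z hpos
  refine ⟨r, by omega, ?_⟩
  have h : g' + z • β (i + 1) - r • β (i + 1) =
      g' + (z / q β (i + 1)) • (q β (i + 1) • β (i + 1)) := by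
    have h := Int.emod_add_mul_ediv z (q β (i + 1))
    rw [hr] at h
    have h' : (z : ℚ) = r + q β (i + 1) * ((z / q β (i + 1) : ℤ) : ℚ) := by exact_mod_cast h.symm
    simp only [zsmul_eq_mul, nsmul_eq_mul]
    rw [h']
    ring
  rw [h]
  exact add_mem hg' (zsmul_mem hqG _)

/-- The elements of `G_i` that are at least `β_{i+1}` belong to `S_i`. -/
theorem mem_S_of_mem_G (h0 : 0 < β 0) (h1 : 0 ≤ β 1) (i : ℕ) :
    (∀ j, 1 ≤ j → j ≤ i → q β j • β j < β (j + 1)) →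
    ∀ {g : ℚ}, g ∈ G β i → β (i + 1) ≤ g → g ∈ S β i := by
  induction i with
  | zero =>
    intro _ g hg hle
    have hG : G β 0 = AddSubgroup.zmultiples (β 0) := by
      rw [G, AddSubgroup.zmultiples_eq_closure, ← Set.image_singleton]
      congr 2
      ext j
      simp
    rw [hG] at hg
    obtain ⟨z, rfl⟩ := AddSubgroup.mem_zmultiples_iff.1 hg
    have hz : 0 ≤ z := by
      by_contra hz
      have h2 : (z : ℚ) < 0 := by exact_mod_cast not_le.1 hz
      have h3 := h1.trans hle
      rw [zsmul_eq_mul] at h3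
      nlinarith
    obtain ⟨n, rfl⟩ := Int.eq_ofNat_of_zero_le hz
    rw [natCast_zsmul]
    exact nsmul_mem (mem_S β le_rfl) n
  | succ i ih =>
    intro hβ g hg hle
    obtain ⟨r, hr, hrG⟩ := exists_sub_nsmul_mem_G h0.ne' i hg
    have hlt := hβ (i + 1) (Nat.le_add_left _ _) le_rfl
    have hS : g - r • β (i + 1) ∈ S β i := by
      refine ih (fun j hj hji => hβ j hj (hji.trans i.le_succ)) hrG ?_
      have hpos : 0 ≤ β (i + 1) := by
        rcases Nat.eq_zero_or_pos i with rfl | hi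
        · exact h1
        · by_contra hneg
          have h2 := hβ i hi i.le_succ
          have h3 : 0 ≤ β i := by
            clear * - hβ h1 hi
            have : ∀ l, l ≤ i → 0 ≤ β (l + 1) := by
              intro l
              induction l with
              | zero => exact fun _ => h1
              | succ l ihl =>
                intro hl
                exact (nsmul_nonneg (ihl (by omega)) _).trans
                  (hβ (l + 1) (by omega) (by omega)).le
            obtain ⟨l, rfl⟩ := Nat.exists_eq_add_of_le' hi
            exact this l (by omega)
          exact hneg ((nsmul_nonneg h3 _).trans h2.le)
      have h2 : (r : ℚ) + 1 ≤ q β (i + 1) := by exact_mod_cast hr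
      rw [nsmul_eq_mul] at hlt ⊢
      nlinarith
    have := add_mem (S_mono β i.le_succ hS) (nsmul_mem (mem_S β (le_refl (i + 1))) r)
    rwa [sub_add_cancel] at this

theorem q_smul_mem_S (h0 : 0 < β 0) (i : ℕ) (hpos : ∀ j, j ≤ i + 1 → 0 ≤ β j)
    (hβ : ∀ j, 1 ≤ j → j ≤ i → q β j • β j < β (j + 1)) :
    q β (i + 1) • β (i + 1) ∈ S β i := by
  obtain ⟨hq, hqG⟩ := q_spec h0.ne' (i + 1)
  refine mem_S_of_mem_G h0 (hpos 1 (by omega)) i hβ hqG ?_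
  rw [nsmul_eq_mul]
  have h1 : (1 : ℚ) ≤ q β (i + 1) := by exact_mod_cast hq
  have := hpos (i + 1) le_rfl
  nlinarith

/-- A monomial in `P_1, …, P_i` that is irreducible with respect to `𝒫_{i+1}` has a smaller value
than `P_{i+1}`. -/
theorem weight_lt_of_irred (h1 : 0 < β 1) (γ : ℕ → ℚ) (i : ℕ) :
    (∀ j, 1 ≤ j → j ≤ i → q β j • β j < β (j + 1)) →
    ∀ a : Mon, (∀ v ∈ a.support, v ∈ Sum.inl '' {j | 1 ≤ j ∧ j ≤ i}) → Irred (PP β (i + 1)) a →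
      weight (Sum.elim β γ) a < β (i + 1) := by
  classical
  induction i with
  | zero =>
    intro _ a ha _
    have : a = 0 := by
      rw [← Finsupp.support_eq_empty, Finset.eq_empty_iff_forall_notMem]
      intro v hv
      obtain ⟨j, hj, -⟩ := ha v hv
      have h := hj.1
      have h' := hj.2
      omega
    rw [this, weight_zero]
    exact h1
  | succ i ih =>
    intro hβ a ha hirr
    have hlt := hβ (i + 1) (Nat.le_add_left _ _) le_rfl
    set b := a.erase (Sum.inl (i + 1)) with hb
    have hab : a = single (Sum.inl (i + 1)) (a (Sum.inl (i + 1))) + b :=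
      (Finsupp.single_add_erase _ _).symm
    have hba : b ≤ a := by
      rw [hab]
      exact le_add_self
    have hwb : weight (Sum.elim β γ) b < β (i + 1) := by
      refine ih (fun j hj hji => hβ j hj (hji.trans i.le_succ)) b ?_ ?_
      · intro v hv
        rw [hb, Finsupp.support_erase, Finset.mem_erase] at hv
        obtain ⟨j, hj, rfl⟩ := ha v hv.2
        refine ⟨j, ⟨hj.1, ?_⟩, rfl⟩
        have h1 := hj.2
        have h2 : j ≠ i + 1 := fun h => hv.1 (by rw [h])
        omega
      · refine (hirr.of_le hba).mono_set ?_
        rintro M ⟨j, hj, hji, rfl⟩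
        exact ⟨j, hj, hji.trans (Nat.lt_succ_self _), rfl⟩
    have hlt2 : a (Sum.inl (i + 1)) + 1 ≤ q β (i + 1) := by
      by_contra hcon
      refine hirr (single (Sum.inl (i + 1)) (q β (i + 1))) ?_
        ⟨i + 1, Nat.succ_pos _, Nat.lt_succ_self _, rfl⟩
      rw [Finsupp.single_le_iff]
      omega
    have h2 : (a (Sum.inl (i + 1)) : ℚ) + 1 ≤ q β (i + 1) := by exact_mod_cast hlt2
    have hpos : 0 < β (i + 1) := by
      refine lt_of_le_of_lt ?_ (ih (fun j hj hji => hβ j hj (hji.trans i.le_succ)) 0 (by simp) ?_)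
      · rw [weight_zero]
      · rintro c hc ⟨j, hj, hji, rfl⟩
        have := (Finsupp.single_le_iff.1 hc)
        simp only [Finsupp.coe_zero, Pi.zero_apply, Nat.le_zero] at this
        refine hirr (single (Sum.inl j) (q β j)) ?_ ⟨j, hj, hji.trans (Nat.lt_succ_self _), rfl⟩
        rw [this, Finsupp.single_zero]
        exact zero_le
    rw [hab, weight_add, weight_single]
    simp only [Sum.elim_inl, nsmul_eq_mul] at hlt ⊢
    nlinarith

end PValues

/-! ### The sets `𝒯_i` and `𝒟_i` -/

section Sets

variable {β γ : ℕ → ℚ} {Z : Set ℕ}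

theorem TT_succ_subset (i : ℕ) : TT β γ Z i ⊆ TT β γ Z (i + 1) := by
  cases i with
  | zero => exact subset_rfl
  | succ i =>
    rw [TT]
    exact Set.subset_union_left

theorem TT_mono : Monotone (TT β γ Z) := monotone_nat_of_le_succ TT_succ_subset

theorem PP_subset_TT (i j : ℕ) : PP β i ⊆ TT β γ Z j :=
  (Set.subset_iUnion (PP β) i).trans ((subset_of_eq (by rw [TT])).trans (TT_mono (Nat.zero_le j)))

theorem single_mem_TT_inl {j : ℕ} (hj : 0 < j) (i : ℕ) :
    single (Sum.inl j) (q β j) ∈ TT β γ Z i :=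
  PP_subset_TT (j + 1) i ⟨j, hj, j.lt_succ_self, rfl⟩

theorem single_mem_TT_inr {j i : ℕ} (hj : 0 < j) (hji : j < i) (hZ : j ∈ Z) :
    single (Sum.inr j) 1 ∈ TT β γ Z i := by
  obtain ⟨l, rfl⟩ := Nat.exists_eq_add_of_le' hj
  refine TT_mono (Nat.succ_le_of_lt hji) ?_
  rw [Nat.succ_eq_add_one, TT, if_pos hZ]
  exact Set.mem_union_right _ rfl

theorem lead_mem_TT {j i : ℕ} (hj : 0 < j) (hji : j < i) (hZ : j ∉ Z) {d : Mon × ℕ}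
    (hd : d ∈ D β γ Z j) : lead β γ j d ∈ TT β γ Z i := by
  obtain ⟨l, rfl⟩ := Nat.exists_eq_add_of_le' hj
  refine TT_mono (Nat.succ_le_of_lt hji) ?_
  rw [Nat.succ_eq_add_one, TT, if_neg hZ]
  rw [D, if_neg hZ] at hd
  exact Set.mem_union_right _ ⟨d, hd, rfl⟩

theorem mem_DD_of_mem_D {i : ℕ} {d : Mon × ℕ} (hd : d ∈ D β γ Z i) :
    i ∉ Z ∧ d ∈ DD β γ i (TT β γ Z i) := by
  by_cases hZ : i ∈ Z
  · rw [D, if_pos hZ] at hd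
    exact hd.elim
  · rw [D, if_neg hZ] at hd
    exact ⟨hZ, hd⟩

/-- The three kinds of elements of `𝒯_i`. -/
theorem mem_TT_cases {i : ℕ} {b : Mon} (hb : b ∈ TT β γ Z i) :
    (∃ j, 0 < j ∧ b = single (Sum.inl j) (q β j)) ∨
    (∃ j, 0 < j ∧ j < i ∧ j ∈ Z ∧ b = single (Sum.inr j) 1) ∨
    (∃ j, 0 < j ∧ j < i ∧ ∃ d ∈ D β γ Z j, b = lead β γ j d) := by
  have hPP : ∀ {b : Mon}, b ∈ ⋃ i, PP β i → ∃ j, 0 < j ∧ b = single (Sum.inl j) (q β j) := by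
    rintro b hb
    obtain ⟨_, j, hj, -, rfl⟩ := Set.mem_iUnion.1 hb
    exact ⟨j, hj, rfl⟩
  induction i with
  | zero => exact Or.inl (hPP (by rwa [TT] at hb))
  | succ i ih =>
    cases i with
    | zero => exact Or.inl (hPP (by rwa [TT] at hb))
    | succ i =>
      rw [TT] at hb
      rcases hb with hb | hb
      · rcases ih hb with h | ⟨j, hj, hji, h⟩ | ⟨j, hj, hji, h⟩
        · exact Or.inl h
        · exact Or.inr (Or.inl ⟨j, hj, hji.trans (Nat.lt_succ_self _), h⟩)
        · exact Or.inr (Or.inr ⟨j, hj, hji.trans (Nat.lt_succ_self _), h⟩)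
      · by_cases hZ : i + 1 ∈ Z
        · rw [if_pos hZ] at hb
          exact Or.inr (Or.inl ⟨i + 1, i.succ_pos, Nat.lt_succ_self _, hZ, hb⟩)
        · rw [if_neg hZ] at hb
          obtain ⟨d, hd, rfl⟩ := hb
          refine Or.inr (Or.inr ⟨i + 1, i.succ_pos, Nat.lt_succ_self _, d, ?_, rfl⟩)
          rwa [D, if_neg hZ]

theorem weight_lead (i : ℕ) (d : Mon × ℕ) : weight (Sum.elim β γ) (lead β γ i d) =
    weight (Sum.elim β γ) d.1 + d.2 • (s β γ i • γ i) := by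
  rw [lead, weight_add, weight_single, mul_nsmul']
  rfl

/-- Below `(a, c)` in the product order, total degrees are strictly smaller. Hence a pair is reduced
if and only if it is minimal in the product order among the pairs with `c > 0` whose value lies in
the semigroup. -/
theorem sum_add_lt_of_le {ι : Type*} {a b : ι →₀ ℕ} {c e : ℕ} (hb : b ≤ a) (he : e ≤ c)
    (hne : (b, e) ≠ (a, c)) : (b.sum fun _ n => n) + e < (a.sum fun _ n => n) + c := by
  have hsum : (a.sum fun _ n => n) = ((a - b).sum fun _ n => n) + (b.sum fun _ n => n) := by
    rw [← Finsupp.sum_add_index' (fun _ => rfl) (fun _ _ _ => rfl), tsub_add_cancel_of_le hb]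
  by_contra hcon
  have h1 : ((a - b).sum fun _ n => n) = 0 := by omega
  have h2 : e = c := by omega
  refine hne (Prod.ext (le_antisymm hb fun v => ?_) h2)
  have h3 : (a - b) v = 0 := by
    by_contra h
    exact h (Finset.sum_eq_zero_iff.1 h1 v (Finsupp.mem_support_iff.2 h))
  rw [Finsupp.tsub_apply] at h3
  change a v ≤ b v
  omega

theorem vars_finite (k i : ℕ) : (vars k i).Finite :=
  ((Set.finite_le_nat k).image _).union (((Set.finite_le_nat i).subset fun _ h => h.2).image _)

/-- The sets `𝒟_i` are finite, by Dickson's lemma. -/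
theorem DD_finite (i : ℕ) (X : Set Mon) : (DD β γ i X).Finite := by
  have : Finite (vars (m β γ i) (i - 1)) := vars_finite _ _
  let φ : Mon × ℕ → (vars (m β γ i) (i - 1) → ℕ) × ℕ := fun d => (fun v => d.1 v, d.2)
  have hle : ∀ d ∈ DD β γ i X, ∀ d' ∈ DD β γ i X, φ d ≤ φ d' → d = d' := by
    rintro ⟨a, c⟩ hd ⟨a', c'⟩ hd' ⟨h1, h2⟩
    by_contra hne
    have hle : a ≤ a' := fun v => by
      by_cases hv : v ∈ a.support
      · exact h1 ⟨v, hd.1 v hv⟩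
      · rw [Finsupp.notMem_support_iff.1 hv]
        exact Nat.zero_le _
    exact hd'.2.2.1.2 a hle c hd.2.1 h2 (sum_add_lt_of_le hle h2 hne) hd.2.2.1.1
  refine Set.Finite.of_finite_image (f := φ) ?_ fun d hd d' hd' h => hle d hd d' hd' h.le
  refine IsAntichain.finite_of_wellQuasiOrdered (r := (· ≤ ·)) ?_ wellQuasiOrdered_le
  rintro _ ⟨d, hd, rfl⟩ _ ⟨d', hd', rfl⟩ hne h
  exact hne (congrArg φ (hle d hd d' hd' h))

theorem D_finite (i : ℕ) : (D β γ Z i).Finite := by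
  rw [D]
  split_ifs
  · exact Set.finite_empty
  · exact DD_finite i _

theorem exists_weight_eq_inl (γ : ℕ → ℚ) {j : ℕ} {g : ℚ} (hg : g ∈ S β j) :
    ∃ N : Mon, (∀ v ∈ N.support, v ∈ Sum.inl '' {l | l ≤ j}) ∧ weight (Sum.elim β γ) N = g := by
  refine exists_weight_eq (Sum.elim β γ) (V := Sum.inl '' {l | l ≤ j}) ?_
  rwa [Set.image_image]

theorem lead_pos (h0 : β 0 ≠ 0) {i : ℕ} {d : Mon × ℕ} (hd : 0 < d.2) :
    0 < lead β γ i d (Sum.inr i) := by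
  rw [lead, Finsupp.add_apply, Finsupp.single_eq_same]
  exact Nat.add_pos_right _ (Nat.mul_pos hd (s_spec γ h0 i).1)

theorem varLT_of_mem_vars {k i : ℕ} (hi : 0 < i) {u : ℕ ⊕ ℕ} (hu : u ∈ vars k (i - 1)) :
    VarLT u (Sum.inr i) := by
  rcases hu with ⟨l, -, rfl⟩ | ⟨l, hl, rfl⟩
  · exact Sum.Lex.sep _ _
  · have := hl.1
    have := hl.2
    exact Sum.Lex.inr (by omega)

theorem lead_eq_zero {i : ℕ} (hi : 0 < i) {d : Mon × ℕ}
    (hd : ∀ v ∈ d.1.support, v ∈ vars (m β γ i) (i - 1)) {u : ℕ ⊕ ℕ} (hu : VarLT (Sum.inr i) u) :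
    lead β γ i d u = 0 := by
  rw [lead, Finsupp.add_apply, Finsupp.single_apply, if_neg, add_zero]
  · by_contra h
    exact asymm_of VarLT hu (varLT_of_mem_vars hi (hd u (Finsupp.mem_support_iff.2 h)))
  · rintro rfl
    exact irrefl_of VarLT _ hu

/-- Each element of `𝒯_i` can be rewritten in terms of smaller variables. -/
theorem exists_isRewriting (h0 : 0 < β 0) (hγ : ∀ j ∈ Z, γ j = 0)
    (hqS : ∀ j, 0 < j → q β j • β j ∈ S β (j - 1)) {i k : ℕ} (hk : ∀ j < i, m β γ j ≤ k)
    {b : Mon} (hb : b ∈ TT β γ Z i) (hbV : ∀ v ∈ b.support, v ∈ vars k (i - 1)) :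
    ∃ v N, IsRewriting (Sum.elim β γ) b v N ∧ ∀ u ∈ N.support, u ∈ vars k (i - 1) := by
  rcases mem_TT_cases hb with ⟨j, hj, rfl⟩ | ⟨j, hj, hji, hZ, rfl⟩ | ⟨j, hj, hji, d, hd, rfl⟩
  · obtain ⟨N, hN, hw⟩ := exists_weight_eq_inl γ (hqS j hj)
    have hq := (q_spec h0.ne' j).1
    have hjk : j ≤ k := by
      refine inl_mem_vars.1 (hbV (Sum.inl j) ?_)
      rw [Finsupp.mem_support_iff, Finsupp.single_eq_same]
      exact hq.ne'
    refine ⟨Sum.inl j, N, ⟨?_, fun u hu => ?_, fun u hu => ?_, ?_⟩, fun u hu => ?_⟩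
    · rwa [Finsupp.single_eq_same]
    · refine Finsupp.single_eq_of_ne' ?_
      rintro rfl
      exact irrefl_of VarLT _ hu
    · obtain ⟨l, hl, rfl⟩ := hN u hu
      exact Sum.Lex.inl (lt_of_le_of_lt hl (Nat.sub_lt hj one_pos))
    · rw [hw, weight_single]
      rfl
    · obtain ⟨l, hl, rfl⟩ := hN u hu
      exact inl_mem_vars.2 ((le_trans hl (Nat.sub_le j 1)).trans hjk)
  · refine ⟨Sum.inr j, 0, ⟨?_, fun u hu => ?_, by simp, ?_⟩, by simp⟩
    · rw [Finsupp.single_eq_same]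
      exact one_pos
    · refine Finsupp.single_eq_of_ne' ?_
      rintro rfl
      exact irrefl_of VarLT _ hu
    · rw [weight_zero, weight_single, Sum.elim_inr, hγ j hZ, nsmul_zero]
  · obtain ⟨-, hdV, hc, hred, -⟩ := mem_DD_of_mem_D hd
    have hred := hred.1
    rw [S_sup_U] at hred
    obtain ⟨N, hN, hw⟩ := exists_weight_eq _ hred
    refine ⟨Sum.inr j, N, ⟨lead_pos h0.ne' hc, fun u => lead_eq_zero hj hdV,
      fun u hu => varLT_of_mem_vars hj (hN u hu), ?_⟩, fun u hu => ?_⟩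
    · rw [hw, weight_lead]
    · exact vars_mono (hk j hji) (by omega) (hN u hu)

/-- Every value in `S_k + U_{i-1}`, where `k ≥ m_{i-1}`, is the value of a monomial in
`P_0, …, P_k, T_1, …, T_{i-1}` that is irreducible with respect to `𝒯_i`. -/
theorem exists_irred_TT (h0 : 0 < β 0) (hγ : ∀ j ∈ Z, γ j = 0)
    (hqS : ∀ j, 0 < j → q β j • β j ∈ S β (j - 1)) {i k : ℕ} (hk : ∀ j < i, m β γ j ≤ k)
    {g : ℚ} (hg : g ∈ S β k ⊔ U γ (i - 1)) :
    ∃ N : Mon, (∀ v ∈ N.support, v ∈ vars k (i - 1)) ∧ weight (Sum.elim β γ) N = g ∧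
      Irred (TT β γ Z i) N := by
  rw [S_sup_U] at hg
  obtain ⟨M, hM, rfl⟩ := exists_weight_eq _ hg
  exact exists_irred _ _ _ (fun b hb hbV => exists_isRewriting h0 hγ hqS hk hb hbV) M hM

/-! ### Irreducible monomials have distinct values -/

/-- If the irreducible monomials `A`, `A'` in `T_1, …, T_i` and the `P_j` have the same value, and
the variable `P_l` with `l > m_i` is the last `P` that occurs in them, then it occurs in both. -/
theorem ne_zero_of_weight_eq (h0 : β 0 ≠ 0) {i l : ℕ} (hl : m β γ i < l) {A A' : Mon}
    (hA : ∀ v ∈ A.support, v ∈ vars l i) (hA' : ∀ v ∈ A'.support, v ∈ vars l i)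
    (hirr : ∀ j, Irred (TT β γ Z j) A)
    (hw : weight (Sum.elim β γ) A = weight (Sum.elim β γ) A')
    (hl0 : A (Sum.inl l) ≠ 0) : A' (Sum.inl l) ≠ 0 := by
  classical
  intro hl0'
  set b := A.erase (Sum.inl l) with hb
  have hab : A = single (Sum.inl l) (A (Sum.inl l)) + b := (Finsupp.single_add_erase _ _).symm
  have hvars : ∀ v ∈ vars l i, v ≠ Sum.inl l → v ∈ vars (l - 1) i := by
    rintro _ (⟨j, hj, rfl⟩ | ⟨j, hj, rfl⟩) hne
    · have h1 : j ≤ l := hj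
      have h2 : j ≠ l := fun h => hne (by rw [h])
      exact inl_mem_vars.2 (by omega)
    · exact inr_mem_vars.2 hj
  have hbG : weight (Sum.elim β γ) b ∈ H γ i ⊔ G β (l - 1) := by
    refine weight_mem_H_sup_G β γ fun v hv => ?_
    rw [hb, Finsupp.support_erase, Finset.mem_erase] at hv
    exact hvars v (hA v hv.2) hv.1
  have hA'G : weight (Sum.elim β γ) A' ∈ H γ i ⊔ G β (l - 1) := by
    refine weight_mem_H_sup_G β γ fun v hv => hvars v (hA' v hv) ?_
    rintro rfl
    exact Finsupp.mem_support_iff.1 hv hl0'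
  -- The exponent of `P_l` is less than `q_l`, so this contradicts the minimality of `q_l`.
  have hmem : A (Sum.inl l) • β l ∈ G β (l - 1) := by
    refine mem_G_of_mem_H_sup_G γ h0 i (by omega) ?_ ?_
    · have hwA : weight (Sum.elim β γ) A = A (Sum.inl l) • β l + weight (Sum.elim β γ) b := by
        conv_lhs => rw [hab, weight_add, weight_single]
        rfl
      rw [← hw, hwA] at hA'G
      have h := sub_mem hA'G hbG
      rwa [add_sub_cancel_right] at h
    · exact nsmul_mem (G_le_iSup β l (mem_G β le_rfl)) _
  have hq := q_le (Nat.pos_of_ne_zero hl0) hmem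
  exact hirr 0 _ (Finsupp.single_le_iff.2 hq) (single_mem_TT_inl (by omega) 0)

theorem le_m_of_weight_eq (h0 : β 0 ≠ 0) {i : ℕ} {A A' : Mon}
    (hA : ∀ j, A (Sum.inr j) ≠ 0 → 1 ≤ j ∧ j ≤ i) (hA' : ∀ j, A' (Sum.inr j) ≠ 0 → 1 ≤ j ∧ j ≤ i)
    (hirr : ∀ j, Irred (TT β γ Z j) A) (hirr' : ∀ j, Irred (TT β γ Z j) A')
    (hw : weight (Sum.elim β γ) A = weight (Sum.elim β γ) A')
    (hdisj : ∀ v, A v = 0 ∨ A' v = 0) :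
    (∀ v ∈ A.support, v ∈ vars (m β γ i) i) ∧ (∀ v ∈ A'.support, v ∈ vars (m β γ i) i) := by
  classical
  -- It suffices to exclude a last `P_l` with `l > m_i`.
  have key : ∀ l, (∀ v ∈ A.support, v ∈ vars l i) → (∀ v ∈ A'.support, v ∈ vars l i) →
      (∀ v ∈ A.support, v ∈ vars (m β γ i) i) ∧ (∀ v ∈ A'.support, v ∈ vars (m β γ i) i) := by
    intro l
    induction l with
    | zero => exact fun h h' => ⟨fun v hv => vars_mono (Nat.zero_le _) le_rfl (h v hv),
        fun v hv => vars_mono (Nat.zero_le _) le_rfl (h' v hv)⟩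
    | succ l ih =>
      intro h h'
      by_cases hl : l + 1 ≤ m β γ i
      · exact ⟨fun v hv => vars_mono hl le_rfl (h v hv), fun v hv => vars_mono hl le_rfl (h' v hv)⟩
      · have h1 := ne_zero_of_weight_eq h0 (not_le.1 hl) h h' hirr hw
        have h2 := ne_zero_of_weight_eq h0 (not_le.1 hl) h' h hirr' hw.symm
        have h3 := hdisj (Sum.inl (l + 1))
        have hstep : ∀ B : Mon, B (Sum.inl (l + 1)) = 0 → (∀ v ∈ B.support, v ∈ vars (l + 1) i) →
            ∀ v ∈ B.support, v ∈ vars l i := by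
          intro B hB hBV v hv
          rcases hBV v hv with ⟨j, hj, rfl⟩ | ⟨j, hj, rfl⟩
          · have hj1 : j ≤ l + 1 := hj
            have hj2 : j ≠ l + 1 := by
              rintro rfl
              exact Finsupp.mem_support_iff.1 hv hB
            exact inl_mem_vars.2 (by omega)
          · exact inr_mem_vars.2 hj
        exact ih (hstep A (by tauto) h) (hstep A' (by tauto) h')
  obtain ⟨l, hl⟩ : ∃ l, ∀ v ∈ A.support ∪ A'.support, ∀ j, v = Sum.inl j → j ≤ l := by
    refine ⟨(A.support ∪ A'.support).sup (Sum.elim id id), fun v hv j hj => ?_⟩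
    have := Finset.le_sup (f := Sum.elim id id) hv
    rwa [hj] at this
  refine key l (fun v hv => ?_) fun v hv => ?_
  · rcases v with j | j
    · exact inl_mem_vars.2 (hl _ (Finset.mem_union_left _ hv) j rfl)
    · exact inr_mem_vars.2 (hA j (Finsupp.mem_support_iff.1 hv))
  · rcases v with j | j
    · exact inl_mem_vars.2 (hl _ (Finset.mem_union_right _ hv) j rfl)
    · exact inr_mem_vars.2 (hA' j (Finsupp.mem_support_iff.1 hv))

/-- If the value `|a| + c μ` with `c > 0` lies in the semigroup, then some reduced pair
divides `(a, c)`. -/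
theorem exists_isReduced {ι : Type*} (Φ : AddSubmonoid ℚ) (w : ι → ℚ) (μ : ℚ) :
    ∀ (n : ℕ) (a : ι →₀ ℕ) (c : ℕ), (a.sum fun _ n => n) + c = n → 0 < c →
      weight w a + c • μ ∈ Φ → ∃ b ≤ a, ∃ e ≤ c, 0 < e ∧ IsReduced Φ w μ b e := by
  intro n
  induction n using Nat.strong_induction_on with
  | _ n ih =>
    intro a c hn hc hmem
    by_cases hred : IsReduced Φ w μ a c
    · exact ⟨a, le_rfl, c, le_rfl, hc, hred⟩
    · rw [IsReduced, not_and] at hred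
      have := hred hmem
      push Not at this
      obtain ⟨b, hb, e, he, hec, hlt, hmem'⟩ := this
      obtain ⟨b', hb', e', he', hpos, h⟩ := ih _ (hn ▸ hlt) b e rfl he hmem'
      exact ⟨b', hb'.trans hb, e', he'.trans hec, hpos, h⟩

/-- The last `T_i` that occurs in two irreducible monomials of the same value occurs in both:
otherwise its exponent in one of them would give rise to a reduced tuple, hence to an element of
`𝒟_i`. -/
theorem ne_zero_of_weight_eq_inr (h0 : β 0 ≠ 0) {i : ℕ} {A A' : Mon}
    (hA : ∀ v ∈ A.support, v ∈ vars (m β γ (i + 1)) (i + 1))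
    (hA' : ∀ v ∈ A'.support, v ∈ vars (m β γ (i + 1)) (i + 1))
    (hirr : ∀ j, Irred (TT β γ Z j) A)
    (hw : weight (Sum.elim β γ) A = weight (Sum.elim β γ) A')
    (hi0 : A (Sum.inr (i + 1)) ≠ 0) : A' (Sum.inr (i + 1)) ≠ 0 := by
  classical
  intro hi0'
  have hZ : i + 1 ∉ Z := fun hZ => hirr (i + 2) (single (Sum.inr (i + 1)) 1)
    (Finsupp.single_le_iff.2 (Nat.pos_of_ne_zero hi0))
    (single_mem_TT_inr i.succ_pos (Nat.lt_succ_self _) hZ)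
  set b := A.erase (Sum.inr (i + 1)) with hb
  have hab : A = single (Sum.inr (i + 1)) (A (Sum.inr (i + 1))) + b :=
    (Finsupp.single_add_erase _ _).symm
  have hvars : ∀ v ∈ vars (m β γ (i + 1)) (i + 1), v ≠ Sum.inr (i + 1) →
      v ∈ vars (m β γ (i + 1)) i := by
    rintro _ (⟨j, hj, rfl⟩ | ⟨j, hj, rfl⟩) hne
    · exact inl_mem_vars.2 hj
    · have h2 : j ≠ i + 1 := fun h => hne (by rw [h])
      have h3 := hj.1
      have h4 := hj.2
      exact inr_mem_vars.2 (by omega)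
  have hbV : ∀ v ∈ b.support, v ∈ vars (m β γ (i + 1)) i := by
    intro v hv
    rw [hb, Finsupp.support_erase, Finset.mem_erase] at hv
    exact hvars v (hA v hv.2) hv.1
  have hA'V : ∀ v ∈ A'.support, v ∈ vars (m β γ (i + 1)) i := by
    refine fun v hv => hvars v (hA' v hv) ?_
    rintro rfl
    exact Finsupp.mem_support_iff.1 hv hi0'
  have hwA : weight (Sum.elim β γ) A =
      A (Sum.inr (i + 1)) • γ (i + 1) + weight (Sum.elim β γ) b := by
    conv_lhs => rw [hab, weight_add, weight_single]
    rfl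
  have hz : ((A (Sum.inr (i + 1)) : ℕ) : ℤ) • γ (i + 1) ∈ H γ (i + 1 - 1) ⊔ ⨆ j, G β j := by
    have h1 := weight_mem_H_sup_G β γ hA'V
    rw [← hw, hwA] at h1
    have h2 := sub_mem h1 (weight_mem_H_sup_G β γ hbV)
    rw [add_sub_cancel_right] at h2
    rw [natCast_zsmul]
    exact sup_le_sup_left (G_le_iSup β _) (H γ i) h2
  obtain ⟨c, hc⟩ := Int.natCast_dvd_natCast.1 (s_dvd γ h0 hz)
  have hcpos : 0 < c := Nat.pos_of_ne_zero fun h => hi0 (by rw [hc, h, mul_zero])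
  have hmem : weight (Sum.elim β γ) b + c • (s β γ (i + 1) • γ (i + 1)) ∈
      S β (m β γ (i + 1)) ⊔ U γ i := by
    rw [← mul_nsmul, ← hc, add_comm (weight _ b), ← hwA, hw]
    exact weight_mem_S_sup_U β γ hA'V
  obtain ⟨a, ha, e, he, hepos, hred⟩ := exists_isReduced _ _ _ _ b c rfl hcpos hmem
  have hba : b ≤ A := by
    rw [hab]
    exact le_add_self
  have hd : (a, e) ∈ D β γ Z (i + 1) := by
    rw [D, if_neg hZ]
    exact ⟨support_subset_of_le ha hbV, hepos, hred, (hirr _).of_le (ha.trans hba)⟩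
  refine hirr (i + 2) _ ?_ (lead_mem_TT i.succ_pos (Nat.lt_succ_self _) hZ hd)
  have hle : e * s β γ (i + 1) ≤ A (Sum.inr (i + 1)) := by
    rw [hc, mul_comm]
    exact Nat.mul_le_mul_left _ he
  rw [lead, add_comm, hab]
  exact add_le_add (Finsupp.single_le_single.2 hle) ha

/-- Two irreducible monomials without common variables and of the same value are trivial. -/
theorem eq_zero_of_weight_eq (h0 : β 0 ≠ 0) (i : ℕ) : ∀ {A A' : Mon},
    (∀ j, A (Sum.inr j) ≠ 0 → 1 ≤ j ∧ j ≤ i) → (∀ j, A' (Sum.inr j) ≠ 0 → 1 ≤ j ∧ j ≤ i) →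
    (∀ j, Irred (TT β γ Z j) A) → (∀ j, Irred (TT β γ Z j) A') →
    weight (Sum.elim β γ) A = weight (Sum.elim β γ) A' →
    (∀ v, A v = 0 ∨ A' v = 0) → A = 0 ∧ A' = 0 := by
  induction i with
  | zero =>
    intro A A' hA hA' hirr hirr' hw hdisj
    obtain ⟨h1, h2⟩ := le_m_of_weight_eq h0 hA hA' hirr hirr' hw hdisj
    have key : ∀ B : Mon, (∀ v ∈ B.support, v ∈ vars (m β γ 0) 0) →
        B = single (Sum.inl 0) (B (Sum.inl 0)) := by
      intro B hB
      refine Finsupp.eq_single_iff.2 ⟨fun v hv => ?_, rfl⟩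
      rcases hB v hv with ⟨j, hj, rfl⟩ | ⟨j, hj, rfl⟩
      · have hj0 : j ≤ 0 := hj
        rw [Nat.le_zero.1 hj0]
        exact Finset.mem_singleton_self _
      · have h3 := hj.1
        have h4 := hj.2
        omega
    have hA0 := key A h1
    have hA0' := key A' h2
    have hw' : A (Sum.inl 0) • β 0 = A' (Sum.inl 0) • β 0 := by
      rw [hA0, hA0', weight_single, weight_single] at hw
      exact hw
    rw [nsmul_eq_mul, nsmul_eq_mul] at hw'
    have heq : A (Sum.inl 0) = A' (Sum.inl 0) := by exact_mod_cast mul_right_cancel₀ h0 hw'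
    have hd := hdisj (Sum.inl 0)
    have e1 : A (Sum.inl 0) = 0 := by omega
    have e2 : A' (Sum.inl 0) = 0 := by omega
    rw [hA0, hA0', e1, e2]
    simp
  | succ i ih =>
    intro A A' hA hA' hirr hirr' hw hdisj
    obtain ⟨h1, h2⟩ := le_m_of_weight_eq h0 hA hA' hirr hirr' hw hdisj
    have h3 := ne_zero_of_weight_eq_inr h0 h1 h2 hirr hw
    have h4 := ne_zero_of_weight_eq_inr h0 h2 h1 hirr' hw.symm
    have h5 := hdisj (Sum.inr (i + 1))
    have hstep : ∀ B : Mon, B (Sum.inr (i + 1)) = 0 →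
        (∀ j, B (Sum.inr j) ≠ 0 → 1 ≤ j ∧ j ≤ i + 1) →
        ∀ j, B (Sum.inr j) ≠ 0 → 1 ≤ j ∧ j ≤ i := by
      intro B hB hBT j hj
      have h6 := hBT j hj
      have h7 : j ≠ i + 1 := by
        rintro rfl
        exact hj hB
      omega
    exact ih (hstep A (by tauto) hA) (hstep A' (by tauto) hA') hirr hirr' hw hdisj

/-- Irreducible monomials are determined by their values. -/
theorem eq_of_weight_eq (h0 : β 0 ≠ 0) {M M' : Mon} (hM0 : M (Sum.inr 0) = 0)
    (hM0' : M' (Sum.inr 0) = 0) (hM : ∀ j, Irred (TT β γ Z j) M)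
    (hM' : ∀ j, Irred (TT β γ Z j) M')
    (hw : weight (Sum.elim β γ) M = weight (Sum.elim β γ) M') : M = M' := by
  classical
  set A := M - M' with hAdef
  set A' := M' - M with hAdef'
  have hAM : A ≤ M := tsub_le_self
  have hAM' : A' ≤ M' := tsub_le_self
  have hadd : A + M' = A' + M := by
    ext v
    simp only [hAdef, hAdef', Finsupp.coe_add, Finsupp.coe_tsub, Pi.add_apply, Pi.sub_apply]
    omega
  have hwA : weight (Sum.elim β γ) A = weight (Sum.elim β γ) A' := by
    have := congrArg (weight (Sum.elim β γ)) hadd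
    rw [weight_add, weight_add, hw] at this
    exact add_right_cancel this
  obtain ⟨i, hi⟩ : ∃ i, ∀ v ∈ M.support ∪ M'.support, ∀ j, v = Sum.inr j → j ≤ i := by
    refine ⟨(M.support ∪ M'.support).sup (Sum.elim id id), fun v hv j hj => ?_⟩
    have := Finset.le_sup (f := Sum.elim id id) hv
    rwa [hj] at this
  have hT : ∀ (B N : Mon), B ≤ N → N (Sum.inr 0) = 0 → N.support ⊆ M.support ∪ M'.support →
      ∀ j, B (Sum.inr j) ≠ 0 → 1 ≤ j ∧ j ≤ i := by
    intro B N hBN hN0 hN j hj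
    have h1 : N (Sum.inr j) ≠ 0 := by
      have := hBN (Sum.inr j)
      omega
    refine ⟨Nat.one_le_iff_ne_zero.2 ?_, hi _ (hN (Finsupp.mem_support_iff.2 h1)) j rfl⟩
    rintro rfl
    exact h1 hN0
  obtain ⟨e1, e2⟩ := eq_zero_of_weight_eq h0 i (hT A M hAM hM0 Finset.subset_union_left)
    (hT A' M' hAM' hM0' Finset.subset_union_right) (fun j => (hM j).of_le hAM)
    (fun j => (hM' j).of_le hAM') hwA (fun v => by
      simp only [hAdef, hAdef', Finsupp.coe_tsub, Pi.sub_apply]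
      omega)
  rw [e1, e2, zero_add, zero_add] at hadd
  exact hadd.symm

end Sets

/-! ### Values and residues of elements of `R` -/

section EvalMon

variable {R ι : Type*} [CommRing R] (Q : ι → R)

theorem evalMon_zero : evalMon Q 0 = 1 := Finsupp.prod_zero_index

theorem evalMon_add (a b : ι →₀ ℕ) : evalMon Q (a + b) = evalMon Q a * evalMon Q b :=
  Finsupp.prod_add_index' (fun _ => pow_zero _) fun _ _ _ => pow_add _ _ _

theorem evalMon_single (v : ι) (n : ℕ) : evalMon Q (single v n) = Q v ^ n :=
  Finsupp.prod_single_index (pow_zero _)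

theorem evalMon_sub_mul {a b : ι →₀ ℕ} (h : b ≤ a) :
    evalMon Q (a - b) * evalMon Q b = evalMon Q a := by
  rw [← evalMon_add, tsub_add_cancel_of_le h]

theorem evalMon_congr {Q' : ι → R} {a : ι →₀ ℕ} (h : ∀ v ∈ a.support, Q v = Q' v) :
    evalMon Q a = evalMon Q' a :=
  Finsupp.prod_congr fun v hv => by rw [h v hv]

variable {Q}

theorem evalMon_ne_zero [IsDomain R] {a : ι →₀ ℕ} (h : ∀ v ∈ a.support, Q v ≠ 0) :
    evalMon Q a ≠ 0 :=
  Finset.prod_ne_zero_iff.2 fun v hv => pow_ne_zero _ (h v hv)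

theorem ne_zero_of_evalMon_ne_zero {a : ι →₀ ℕ} (h : evalMon Q a ≠ 0) :
    ∀ v ∈ a.support, Q v ≠ 0 := fun v hv h0 =>
  h (Finset.prod_eq_zero hv (by simp only [h0, zero_pow (Finsupp.mem_support_iff.1 hv)]))

end EvalMon

section Values

variable {k K R : Type*} [Field k] [Field K] [Algebra k K] [CommRing R] [Algebra R K]
  {ν : AddValuation K (WithTop ℚ)}

theorem val_zero : val ν (0 : R) = 0 := by
  rw [val, map_zero, AddValuation.map_zero, WithTop.untopD_top]

/-- As `k` is algebraically closed and `ν` is zero-dimensional, the residue field of `ν` is `k`. -/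
theorem exists_lt_map_sub [IsAlgClosed k] (hk : ∀ c : k, c ≠ 0 → ν (algebraMap k K c) = 0)
    (hzero : IsZeroDimensional k ν) {u : K} (hu : 0 ≤ ν u) :
    ∃ c : k, 0 < ν (u - algebraMap k K c) := by
  obtain ⟨p, hp, hpos⟩ := hzero u hu
  by_contra! hcon
  rw [(IsAlgClosed.splits p).eq_prod_roots, map_mul, Polynomial.aeval_C, AddValuation.map_mul,
    hk _ (Polynomial.leadingCoeff_ne_zero.2 hp), zero_add] at hpos
  refine absurd hpos (not_lt.2 ?_)
  induction p.roots using Multiset.induction with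
  | empty => simp
  | cons a s ih =>
    rw [Multiset.map_cons, Multiset.prod_cons, map_mul, AddValuation.map_mul]
    refine add_nonpos ?_ ih
    simpa using hcon a

variable [IsFractionRing R K]

theorem map_eq_val {f : R} (hf : f ≠ 0) : ν (algebraMap R K f) = (val ν f : WithTop ℚ) := by
  have : ν (algebraMap R K f) ≠ ⊤ :=
    ν.ne_top_iff.2 ((map_ne_zero_iff _ (IsFractionRing.injective R K)).2 hf)
  obtain ⟨a, ha⟩ := WithTop.ne_top_iff_exists.1 this
  rw [val, ← ha, WithTop.untopD_coe]

theorem map_evalMon {ι : Type*} {Q : ι → R} {w : ι → ℚ} (hw : ∀ v, w v = val ν (Q v))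
    {a : ι →₀ ℕ} (h : ∀ v ∈ a.support, Q v ≠ 0) :
    ν (algebraMap R K (evalMon Q a)) = (weight w a : WithTop ℚ) := by
  induction a using Finsupp.induction with
  | zero => simp [evalMon_zero, weight_zero]
  | single_add v n a hv hn ih =>
    classical
    have hsupp : (single v n + a).support = {v} ∪ a.support := by
      rw [Finsupp.support_add_eq, Finsupp.support_single v hn]
      rw [Finsupp.support_single v hn]
      exact Finset.disjoint_singleton_left.2 hv
    rw [evalMon_add, evalMon_single, map_mul, map_pow, AddValuation.map_mul, AddValuation.map_pow,
      map_eq_val (h v (by simp [hsupp])), ← hw, ih fun u hu => h u (by rw [hsupp]; simp [hu]),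
      weight_add, weight_single, WithTop.coe_add, WithTop.coe_nsmul]

/-- Elements of the same value have a residue. -/
theorem exists_isResidue [IsAlgClosed k] (hk : ∀ c : k, c ≠ 0 → ν (algebraMap k K c) = 0)
    (hzero : IsZeroDimensional k ν) {f g : R} (h : f ≠ 0 → g ≠ 0 →
      ν (algebraMap R K f) = ν (algebraMap R K g)) : ∃ c : k, IsResidue ν f g c := by
  refine exists_lt_map_sub hk hzero ?_
  by_cases hf : f = 0
  · simp [hf]
  by_cases hg : g = 0
  · simp [hg]
  have hg' : algebraMap R K g ≠ 0 := (map_ne_zero_iff _ (IsFractionRing.injective R K)).2 hg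
  have h1 : ν (algebraMap R K f / algebraMap R K g) + ν (algebraMap R K g) =
      0 + ν (algebraMap R K g) := by
    rw [← AddValuation.map_mul, div_mul_cancel₀ _ hg', h hf hg, zero_add]
  have h2 : ν (algebraMap R K g) ≠ ⊤ := ν.ne_top_iff.2 hg'
  obtain ⟨a, ha⟩ := WithTop.ne_top_iff_exists.1 h2
  rw [← ha] at h1
  exact (WithTop.add_right_cancel WithTop.coe_ne_top h1).ge

/-- The value jumps: `ν(f - c g) > ν(g)` if `c` is the residue of `f / g`. -/
theorem lt_map_sub_of_isResidue [Algebra k R] [IsScalarTower k R K] {f g : R} (hg : g ≠ 0) {c : k} (h : IsResidue ν f g c) :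
    ν (algebraMap R K g) < ν (algebraMap R K (f - algebraMap k R c * g)) := by
  have hg' : algebraMap R K g ≠ 0 := (map_ne_zero_iff _ (IsFractionRing.injective R K)).2 hg
  have h1 : algebraMap R K (f - algebraMap k R c * g) =
      (algebraMap R K f / algebraMap R K g - algebraMap k K c) * algebraMap R K g := by
    rw [map_sub, map_mul, ← IsScalarTower.algebraMap_apply, sub_mul, div_mul_cancel₀ _ hg']
  have h2 : ν (algebraMap R K g) ≠ ⊤ := ν.ne_top_iff.2 hg'
  rw [h1, AddValuation.map_mul]
  have := WithTop.add_lt_add_right h2 h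
  rwa [zero_add] at this

end Values

/-! ### Regular parameters -/

/-- `x` and `y` are independent: no power of `y` is divisible by `x`. Otherwise the maximal ideal
would be minimal over `(x, z)`, contradicting Krull's height theorem. -/
theorem not_dvd_pow {R : Type*} [CommRing R] [IsLocalRing R] [IsNoetherianRing R]
    (hdim : ringKrullDim R = 3) {x y z : R}
    (hxyz : IsLocalRing.maximalIdeal R = Ideal.span {x, y, z}) (n : ℕ) : ¬ x ∣ y ^ n := by
  rintro hdvd
  have hx : x ∈ IsLocalRing.maximalIdeal R := hxyz ▸ Ideal.subset_span (by simp)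
  have hz : z ∈ IsLocalRing.maximalIdeal R := hxyz ▸ Ideal.subset_span (by simp)
  have hle : Ideal.span {x, z} ≤ IsLocalRing.maximalIdeal R := by
    rw [Ideal.span_le]
    rintro a (rfl | rfl)
    exacts [hx, hz]
  have hmin : IsLocalRing.maximalIdeal R ∈ (Ideal.span {x, z}).minimalPrimes := by
    refine ⟨⟨inferInstance, hle⟩, fun p hp _ => ?_⟩
    have := hp.1
    have hxp : x ∈ p := hp.2 (Ideal.subset_span (by simp))
    have hzp : z ∈ p := hp.2 (Ideal.subset_span (by simp))
    rw [hxyz, Ideal.span_le]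
    rintro a (rfl | rfl | rfl)
    exacts [hxp, hp.1.mem_of_pow_mem n (p.mem_of_dvd hdvd hxp), hzp]
  have h1 := Ideal.height_le_spanRank_toENat_of_mem_minimalPrimes _ _ hmin
  have h2 : (Ideal.span {x, z}).spanRank.toENat ≤ 2 := by
    classical
    rw [Submodule.spanRank_toENat_eq_iInf_finset_card]
    refine (iInf_le _ ⟨{x, z}, by simp⟩).trans ?_
    exact_mod_cast Finset.card_le_two
  have h3 := IsLocalRing.maximalIdeal_height_eq_ringKrullDim (R := R)
  rw [hdim] at h3
  have h4 : (IsLocalRing.maximalIdeal R).height = 3 := WithBot.coe_injective (h3.trans rfl)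
  rw [h4] at h1
  exact absurd (h1.trans h2) (by decide)

/-! ### The jumping polynomials `P_i` -/

section NextP

variable {k K R : Type*} [Field k] [Field K] [Algebra k K] [CommRing R] [Algebra k R] [Algebra R K]

/-- `a` is a possible choice for `P_{i+1}`. -/
def IsNextP (k : Type*) {R K : Type*} [Field k] [CommRing R] [Field K] [Algebra k R] [Algebra R K]
    [Algebra k K] (ν : AddValuation K (WithTop ℚ)) (P T : ℕ → R) (β γ : ℕ → ℚ) (i : ℕ) (a : R) :
    Prop :=
  ∃ (n : Mon) (lam : k),
    (∀ v ∈ n.support, v ∈ Sum.inl '' {j | j < i}) ∧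
    q β i • β i = weight (Sum.elim β γ) n ∧
    Irred (PP β i) n ∧
    IsResidue ν (P i ^ q β i) (evalMon (Sum.elim P T) n) lam ∧
    a = P i ^ q β i - algebraMap k R lam * evalMon (Sum.elim P T) n

variable [IsDomain R] [IsScalarTower k R K] [IsFractionRing R K] {ν : AddValuation K (WithTop ℚ)}
  {x y : R} {P T : ℕ → R} {β γ : ℕ → ℚ}

/-- The polynomials `P_i` with `i > 0` are powers of `y` modulo `x`, hence nonzero, and their values
satisfy `β_{i+1} > q_i β_i`. -/
theorem P_properties (hx : x ≠ 0) (hxpos : 0 < val ν x) (hypos : 0 < val ν y)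
    (hxy : ∀ n, ¬ x ∣ y ^ n) (h0 : P 0 = x) (h1 : P 1 = y) (hβ : ∀ i, β i = val ν (P i))
    (n : ℕ) : (∀ i, 0 < i → i < n → IsNextP k ν P T β γ i (P (i + 1))) →
    (∀ j ≤ n, P j ≠ 0 ∧ 0 < β j) ∧ (∀ j ≤ n, 0 < j → ∃ e, x ∣ P j - y ^ e) ∧
      ∀ i, 1 ≤ i → i < n → q β i • β i < β (i + 1) := by
  have hy : y ≠ 0 := by
    rintro rfl
    exact hxy 1 (by simp)
  have hb0 : β 0 ≠ 0 := by
    rw [hβ, h0]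
    exact hxpos.ne'
  induction n with
  | zero =>
    refine fun _ => ⟨fun j hj => ?_, fun j hj hj' => by omega, fun i hi hi' => by omega⟩
    rw [Nat.le_zero.1 hj, hβ, h0]
    exact ⟨hx, hxpos⟩
  | succ n ih =>
    intro hstep
    obtain ⟨ih1, ih2, ih3⟩ := ih fun i hi hin => hstep i hi (hin.trans n.lt_succ_self)
    rcases Nat.eq_zero_or_pos n with rfl | hn
    · refine ⟨fun j hj => ?_, fun j hj hj' => ⟨1, ?_⟩, fun i hi hi' => by omega⟩
      · rcases Nat.le_one_iff_eq_zero_or_eq_one.1 hj with rfl | rfl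
        · exact ih1 0 le_rfl
        · rw [hβ, h1]
          exact ⟨hy, hypos⟩
      · obtain rfl : j = 1 := by omega
        rw [h1, pow_one, sub_self]
        exact dvd_zero x
    · obtain ⟨N, lam, hN, hw, hirr, hres, hP⟩ := hstep n hn n.lt_succ_self
      have hq := (q_spec hb0 n).1
      -- The monomial involves `x`, as its value `q_n β_n` is too large for one without `x`.
      have hN0 : N (Sum.inl 0) ≠ 0 := by
        intro hN0
        obtain ⟨l, rfl⟩ := Nat.exists_eq_add_of_le' hn
        have hlt := weight_lt_of_irred (ih1 1 (by omega)).2 γ l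
          (fun j hj hjl => ih3 j hj (Nat.lt_succ_of_le hjl)) N (fun v hv => ?_) hirr
        · rw [← hw] at hlt
          have h2 : (1 : ℚ) ≤ q β (l + 1) := by exact_mod_cast hq
          have h3 := (ih1 (l + 1) le_rfl).2
          rw [nsmul_eq_mul] at hlt
          nlinarith
        · obtain ⟨j, hj, rfl⟩ := hN v hv
          have hj1 : j < l + 1 := hj
          refine ⟨j, ⟨Nat.one_le_iff_ne_zero.2 ?_, Nat.lt_succ_iff.1 hj1⟩, rfl⟩
          rintro rfl
          exact Finsupp.mem_support_iff.1 hv hN0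
      have hxN : x ∣ evalMon (Sum.elim P T) N := by
        have h2 : Sum.elim P T (Sum.inl 0) ^ N (Sum.inl 0) ∣ evalMon (Sum.elim P T) N :=
          Finset.dvd_prod_of_mem (fun v => Sum.elim P T v ^ N v) (Finsupp.mem_support_iff.2 hN0)
        rw [Sum.elim_inl, h0] at h2
        exact (dvd_pow_self x hN0).trans h2
      obtain ⟨e, he⟩ := ih2 n le_rfl hn
      have hdvd : x ∣ P (n + 1) - y ^ (e * q β n) := by
        have h2 : P (n + 1) - y ^ (e * q β n) = (P n ^ q β n - (y ^ e) ^ q β n) -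
            algebraMap k R lam * evalMon (Sum.elim P T) N := by
          rw [hP, pow_mul]
          ring
        rw [h2]
        exact dvd_sub (he.trans (sub_dvd_pow_sub_pow _ _ _)) (hxN.mul_left _)
      have hne : P (n + 1) ≠ 0 := by
        intro h2
        rw [h2, zero_sub, dvd_neg] at hdvd
        exact hxy _ hdvd
      have hNne : ∀ v ∈ N.support, Sum.elim P T v ≠ 0 := by
        intro v hv
        obtain ⟨j, hj, rfl⟩ := hN v hv
        exact (ih1 j (le_of_lt hj)).1
      have hwN : ν (algebraMap R K (evalMon (Sum.elim P T) N)) =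
          (weight (Sum.elim β γ) N : WithTop ℚ) := by
        rw [map_evalMon (w := fun v => val ν (Sum.elim P T v)) (fun _ => rfl) hNne]
        congr 1
        refine weight_congr fun v hv => ?_
        obtain ⟨j, hj, rfl⟩ := hN v hv
        exact (hβ j).symm
      have hlt : q β n • β n < β (n + 1) := by
        have h2 := lt_map_sub_of_isResidue (evalMon_ne_zero hNne) hres
        rw [← hP, hwN, map_eq_val hne, ← hw, ← hβ] at h2
        exact_mod_cast h2
      refine ⟨fun j hj => ?_, fun j hj hj' => ?_, fun i hi hi' => ?_⟩
      · rcases Nat.le_succ_iff.1 hj with hj | rfl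
        · exact ih1 j hj
        · exact ⟨hne, (nsmul_nonneg (ih1 n le_rfl).2.le _).trans_lt hlt⟩
      · rcases Nat.le_succ_iff.1 hj with hj | rfl
        · exact ih2 j hj hj'
        · exact ⟨_, hdvd⟩
      · rcases Nat.lt_succ_iff_lt_or_eq.1 hi' with hi' | rfl
        · exact ih3 i hi hi'
        · exact hlt

end NextP

/-! ### Rewriting products of jumping polynomials -/

section Jumping

variable {k K R : Type*} [Field k] [Field K] [Algebra k K] [CommRing R] [Algebra k R]
  [Algebra R K] {ν : AddValuation K (WithTop ℚ)}
  {x y z : R} {P T : ℕ → R} {β γ : ℕ → ℚ} {Z : Set ℕ}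

theorem IsJumpingSequence.elim_eq_val (h : IsJumpingSequence k ν x y z P T β γ Z) (v : ℕ ⊕ ℕ) :
    Sum.elim β γ v = val ν (Sum.elim P T v) := by
  rcases v with i | i
  exacts [h.beta_eq i, h.gamma_eq i]

/-- A monomial that is irreducible with respect to `𝒯_i` involves no `T_j = 0` with `j < i`. -/
theorem IsJumpingSequence.ne_zero_of_irred (h : IsJumpingSequence k ν x y z P T β γ Z)
    (hP : ∀ j, P j ≠ 0) {i : ℕ} {N : Mon} (hirr : Irred (TT β γ Z i) N)
    (hN : ∀ j, N (Sum.inr j) ≠ 0 → 0 < j ∧ j < i) : ∀ v ∈ N.support, Sum.elim P T v ≠ 0 := by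
  rintro (j | j) hv
  · exact hP j
  · intro h0
    obtain ⟨hj, hji⟩ := hN j (Finsupp.mem_support_iff.1 hv)
    refine hirr (single (Sum.inr j) 1) ?_ (single_mem_TT_inr hj hji ((h.zero_iff j).2 h0))
    exact Finsupp.single_le_iff.2 (Nat.pos_of_ne_zero (Finsupp.mem_support_iff.1 hv))

variable [IsDomain R] [IsScalarTower k R K] [IsFractionRing R K]

/-- An element of some `𝒯_i` whose product in `R` is nonzero can be rewritten: it is a constant multiple
of a monomial `N` of the same value in smaller variables, plus a member of the family
`P_0, P_1, …, T_1, T_2, …`, which has a larger value. -/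
theorem IsJumpingSequence.exists_reduction (h : IsJumpingSequence k ν x y z P T β γ Z)
    (hP : ∀ j, P j ≠ 0) (h0 : β 0 ≠ 0) {i : ℕ} {b : Mon} (hb : b ∈ TT β γ Z i)
    (hne : evalMon (Sum.elim P T) b ≠ 0) :
    ∃ (v : ℕ ⊕ ℕ) (N : Mon) (c : k) (u : ℕ ⊕ ℕ), IsRewriting (Sum.elim β γ) b v N ∧
      N (Sum.inr 0) = 0 ∧ u ≠ Sum.inr 0 ∧
      evalMon (Sum.elim P T) b = algebraMap k R c * evalMon (Sum.elim P T) N + Sum.elim P T u ∧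
      (weight (Sum.elim β γ) b : WithTop ℚ) < ν (algebraMap R K (Sum.elim P T u)) := by
  rcases mem_TT_cases hb with ⟨j, hj, rfl⟩ | ⟨j, hj, hji, hZ, rfl⟩ | ⟨j, hj, hji, d, hd, rfl⟩
  · obtain ⟨N, lam, hN, hw, hirr, hres, hP'⟩ := h.P_succ j hj
    have hwb : weight (Sum.elim β γ) (single (Sum.inl j) (q β j)) = weight (Sum.elim β γ) N := by
      rw [weight_single, Sum.elim_inl, hw]
    have hNne : ∀ v ∈ N.support, Sum.elim P T v ≠ 0 := by
      intro v hv
      obtain ⟨l, hl, rfl⟩ := hN v hv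
      exact hP l
    refine ⟨Sum.inl j, N, lam, Sum.inl (j + 1), ⟨?_, fun u hu => ?_, fun u hu => ?_, hwb.symm⟩,
      ?_, Sum.inl_ne_inr, ?_, ?_⟩
    · rw [Finsupp.single_eq_same]
      exact (q_spec h0 j).1
    · refine Finsupp.single_eq_of_ne' ?_
      rintro rfl
      exact irrefl_of VarLT _ hu
    · obtain ⟨l, hl, rfl⟩ := hN u hu
      exact Sum.Lex.inl hl
    · by_contra hN0
      obtain ⟨l, -, hl⟩ := hN _ (Finsupp.mem_support_iff.2 hN0)
      exact Sum.inl_ne_inr hl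
    · rw [evalMon_single, Sum.elim_inl, Sum.elim_inl, hP']
      ring
    · rw [hwb, ← map_evalMon h.elim_eq_val hNne, Sum.elim_inl, hP']
      exact lt_map_sub_of_isResidue (evalMon_ne_zero hNne) hres
  · rw [evalMon_single, Sum.elim_inr, (h.zero_iff j).1 hZ, pow_one] at hne
    exact absurd rfl hne
  · obtain ⟨hZ, hdV, hc, -⟩ := mem_DD_of_mem_D hd
    obtain ⟨e, -, he⟩ := h.T_succ j hj fun h1 => hZ ((h.zero_iff j).2 h1)
    obtain ⟨N, mu, hN, hw, hirr, hres, hT⟩ := he (e.symm ⟨d, hd⟩)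
    rw [Equiv.apply_symm_apply] at hw hres hT
    have hNne : ∀ v ∈ N.support, Sum.elim P T v ≠ 0 := by
      refine h.ne_zero_of_irred hP hirr fun l hl => ?_
      have := inr_mem_vars.1 (hN _ (Finsupp.mem_support_iff.2 hl))
      omega
    refine ⟨Sum.inr j, N, mu,
      Sum.inr ((∑ l ∈ Finset.range j, δ β γ Z l) + ((e.symm ⟨d, hd⟩ : ℕ) + 1)), ⟨lead_pos h0 hc, fun u => lead_eq_zero hj hdV,
      fun u hu => varLT_of_mem_vars hj (hN u hu), hw.symm⟩, ?_, ?_, ?_, ?_⟩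
    · by_contra hN0
      have := inr_mem_vars.1 (hN _ (Finsupp.mem_support_iff.2 hN0))
      omega
    · intro h2
      have := Sum.inr_injective h2
      omega
    · rw [Sum.elim_inr, hT]
      ring
    · rw [hw, ← map_evalMon h.elim_eq_val hNne, Sum.elim_inr, hT]
      exact lt_map_sub_of_isResidue (evalMon_ne_zero hNne) hres

end Jumping

/-! ### Value ideals -/

section Ideals

variable {K R : Type*} [Field K] [CommRing R] [Algebra R K] (ν : AddValuation K (WithTop ℚ))

/-- The ideal of all elements of value at least `σ`. -/
def valueIdeal (hν : ∀ f : R, 0 ≤ ν (algebraMap R K f)) (σ : ℚ) : Ideal R where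
  carrier := {f | (σ : WithTop ℚ) ≤ ν (algebraMap R K f)}
  zero_mem' := by simp
  add_mem' := fun {a b} ha hb => by
    change _ ≤ ν _
    rw [map_add]
    exact ν.map_le_add ha hb
  smul_mem' := fun c f hf => by
    change _ ≤ ν _
    rw [smul_eq_mul, map_mul, AddValuation.map_mul]
    exact le_add_of_nonneg_of_le (hν c) hf

/-- The ideal generated by the products of members of the family `Q` of value at least `σ`. -/
def monomialIdeal {ι : Type*} (Q : ι → R) (σ : ℚ) : Ideal R :=
  Ideal.span {g : R | ∃ b : ι →₀ ℕ, g = evalMon Q b ∧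
    (σ : WithTop ℚ) ≤ ν (algebraMap R K (evalMon Q b))}

variable {ν}

theorem monomialIdeal_le {ι : Type*} (Q : ι → R) (hν : ∀ f : R, 0 ≤ ν (algebraMap R K f)) (σ : ℚ) :
    monomialIdeal ν Q σ ≤ valueIdeal ν hν σ := by
  refine Ideal.span_le.2 ?_
  rintro _ ⟨b, rfl, hb⟩
  exact hb

theorem mem_monomialIdeal_pow {ι : Type*} (Q : ι → R) (v : ι)
    (hv : 0 < ν (algebraMap R K (Q v))) (σ : ℚ) : ∃ n : ℕ, Q v ^ n ∈ monomialIdeal ν Q σ := by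
  have key : ∃ n : ℕ, (σ : WithTop ℚ) ≤ ν (algebraMap R K (Q v ^ n)) := by
    rcases eq_or_ne (ν (algebraMap R K (Q v))) ⊤ with h | h
    · exact ⟨1, by rw [pow_one, h]; exact le_top⟩
    · obtain ⟨a, ha⟩ := WithTop.ne_top_iff_exists.1 h
      rw [← ha] at hv
      obtain ⟨n, hn⟩ := Archimedean.arch σ (show (0 : ℚ) < a by exact_mod_cast hv)
      refine ⟨n, ?_⟩
      rw [map_pow, AddValuation.map_pow, ← ha, ← WithTop.coe_nsmul]
      exact_mod_cast hn
  obtain ⟨n, hn⟩ := key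
  have h1 : evalMon Q (single v n) = Q v ^ n := evalMon_single Q v n
  exact ⟨n, Ideal.subset_span ⟨single v n, h1.symm, by rwa [h1]⟩⟩

/-- As `R` has finite length modulo a power of its maximal ideal, an increasing sequence of values
of elements of `R` that is bounded by `σ` is finite. -/
theorem wellFounded_values [IsLocalRing R] [IsNoetherianRing R]
    (hν : ∀ f : R, 0 ≤ ν (algebraMap R K f)) {σ : ℚ} {n : ℕ}
    (hn : IsLocalRing.maximalIdeal R ^ n ≤ valueIdeal ν hν σ) :
    WellFounded fun a b : {ρ : ℚ // ρ ∈ valueSemigroup ν R ∧ ρ < σ} => b < a := by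
  set I : Ideal R := IsLocalRing.maximalIdeal R ^ (n + 1) with hI
  have hmin : IsLocalRing.maximalIdeal R ∈ I.minimalPrimes := by
    refine ⟨⟨inferInstance, Ideal.pow_le_self n.succ_ne_zero⟩, fun p hp _ => ?_⟩
    have := hp.1
    exact Ideal.IsPrime.le_of_pow_le hp.2
  have hart : IsArtinianRing (R ⧸ I) :=
    IsLocalRing.quotient_artinian_of_mem_minimalPrimes_of_isLocalRing I hmin
  have hwf : WellFounded ((· < ·) : Ideal (R ⧸ I) → Ideal (R ⧸ I) → Prop) := wellFounded_lt
  have hIle : ∀ ρ : ℚ, ρ ≤ σ → I ≤ valueIdeal ν hν ρ := by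
    intro ρ hρ f hf
    have h1 : (σ : WithTop ℚ) ≤ ν (algebraMap R K f) := hn (Ideal.pow_le_pow_right n.le_succ hf)
    exact le_trans (by exact_mod_cast hρ) h1
  have hcomap : ∀ ρ : ℚ, ρ ≤ σ → ((valueIdeal ν hν ρ).map (Ideal.Quotient.mk I)).comap
      (Ideal.Quotient.mk I) = valueIdeal ν hν ρ := by
    intro ρ hρ
    rw [Ideal.comap_map_of_surjective' _ Ideal.Quotient.mk_surjective, Ideal.mk_ker]
    exact sup_eq_left.2 (hIle ρ hρ)
  refine Subrelation.wf (r := InvImage (· < ·) fun a : {ρ : ℚ // ρ ∈ valueSemigroup ν R ∧ ρ < σ} =>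
    (valueIdeal ν hν a).map (Ideal.Quotient.mk I)) ?_ (InvImage.wf _ hwf)
  rintro ⟨a, ha, haσ⟩ ⟨b, ⟨f, hf0, hf⟩, hbσ⟩ hab
  have hab' : b < a := hab
  refine lt_of_le_of_ne (Ideal.map_mono fun g hg => ?_) fun heq => ?_
  · have h1 : (a : WithTop ℚ) ≤ ν (algebraMap R K g) := hg
    exact le_trans (by exact_mod_cast hab'.le) h1
  · have h2 := congrArg (Ideal.comap (Ideal.Quotient.mk I)) heq
    simp only at h2
    rw [hcomap a haσ.le, hcomap b hbσ.le] at h2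
    have h3 : f ∈ valueIdeal ν hν b := hf.ge
    rw [← h2] at h3
    have h4 : (a : WithTop ℚ) ≤ ν (algebraMap R K f) := h3
    rw [hf] at h4
    exact absurd (by exact_mod_cast h4) (not_le.2 hab')

end Ideals

/-! ### Expansion in irreducible monomials -/

section Expansion

variable {k K R : Type*} [Field k] [Field K] [Algebra k K] [CommRing R] [Algebra k R]
  [Algebra R K] {ν : AddValuation K (WithTop ℚ)} {x y z : R} {P T : ℕ → R} {β γ : ℕ → ℚ} {Z : Set ℕ}

theorem exists_evalMon_eq (P T : ℕ → R) {M : Mon} (hM : M (Sum.inr 0) = 0) :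
    ∃ b : Mon, evalMon (Sum.elim P fun i => T (i + 1)) b = evalMon (Sum.elim P T) M := by
  have h : evalMon (Sum.elim P T) M ∈
      Submonoid.closure (Set.range (Sum.elim P fun i => T (i + 1))) := by
    refine Submonoid.prod_mem _ fun v hv => pow_mem (Submonoid.subset_closure ?_) _
    rcases v with j | j
    · exact ⟨Sum.inl j, rfl⟩
    · cases j with
      | zero => exact absurd hM (Finsupp.mem_support_iff.1 hv)
      | succ j => exact ⟨Sum.inr j, rfl⟩
  obtain ⟨b, hb⟩ := Submonoid.mem_closure_range_iff.1 h
  exact ⟨b, hb.symm⟩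

theorem evalMon_mem_monomialIdeal {M : Mon} (hM : M (Sum.inr 0) = 0) {σ : ℚ}
    (hσ : (σ : WithTop ℚ) ≤ ν (algebraMap R K (evalMon (Sum.elim P T) M))) :
    evalMon (Sum.elim P T) M ∈ monomialIdeal ν (Sum.elim P fun i => T (i + 1)) σ := by
  obtain ⟨b, hb⟩ := exists_evalMon_eq P T hM
  exact Ideal.subset_span ⟨b, hb.symm, by rwa [hb]⟩

/-- The monomials that are irreducible with respect to `⋃ 𝒯_i` and have value less than `σ`. -/
def irredBelow (β γ : ℕ → ℚ) (Z : Set ℕ) (σ : ℚ) : Set Mon :=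
  {M | M (Sum.inr 0) = 0 ∧ (∀ j, Irred (TT β γ Z j) M) ∧ weight (Sum.elim β γ) M < σ}

/-- The `k`-space spanned by the irreducible monomials of value less than `σ` and the ideal generated
by the monomials of value at least `σ`. It turns out to be all of `R`. -/
def expansions (k : Type*) {R K : Type*} [Field k] [CommRing R] [Field K] [Algebra k R]
    [Algebra R K] (ν : AddValuation K (WithTop ℚ)) (P T : ℕ → R) (β γ : ℕ → ℚ) (Z : Set ℕ) (σ : ℚ) :
    Submodule k R :=
  Submodule.span k (evalMon (Sum.elim P T) '' irredBelow β γ Z σ) ⊔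
    (monomialIdeal ν (Sum.elim P fun i => T (i + 1)) σ).restrictScalars k

theorem exists_adjoin_sub_mem_pow [IsLocalRing R] (hres : ∀ f : R, ∃ c : k, f - algebraMap k R c ∈
      IsLocalRing.maximalIdeal R) (hxyz : IsLocalRing.maximalIdeal R = Ideal.span {x, y, z})
    (n : ℕ) : ∀ f : R, ∃ w ∈ Algebra.adjoin k {x, y, z}, f - w ∈ IsLocalRing.maximalIdeal R ^ n := by
  induction n with
  | zero => exact fun f => ⟨0, zero_mem _, by simp⟩
  | succ n ih =>
    intro f
    obtain ⟨c, hc⟩ := hres f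
    have hc' := hc
    rw [hxyz, Ideal.mem_span_insert] at hc'
    obtain ⟨f₁, g, hg, hf⟩ := hc'
    obtain ⟨f₂, f₃, hg⟩ := Ideal.mem_span_pair.1 hg
    obtain ⟨w₁, hw₁, h₁⟩ := ih f₁
    obtain ⟨w₂, hw₂, h₂⟩ := ih f₂
    obtain ⟨w₃, hw₃, h₃⟩ := ih f₃
    have hm : ∀ a ∈ ({x, y, z} : Set R), a ∈ IsLocalRing.maximalIdeal R := fun a ha =>
      hxyz ▸ Ideal.subset_span ha
    have ha : ∀ a ∈ ({x, y, z} : Set R), a ∈ Algebra.adjoin k {x, y, z} := fun a ha =>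
      Algebra.subset_adjoin ha
    refine ⟨algebraMap k R c + (w₁ * x + (w₂ * y + w₃ * z)),
      add_mem (Subalgebra.algebraMap_mem _ c) (add_mem (mul_mem hw₁ (ha x (by simp)))
        (add_mem (mul_mem hw₂ (ha y (by simp))) (mul_mem hw₃ (ha z (by simp))))), ?_⟩
    have h : f - (algebraMap k R c + (w₁ * x + (w₂ * y + w₃ * z))) =
        (f₁ - w₁) * x + ((f₂ - w₂) * y + (f₃ - w₃) * z) := by
      linear_combination hf - hg
    rw [h, pow_succ]
    exact add_mem (Ideal.mul_mem_mul h₁ (hm x (by simp)))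
      (add_mem (Ideal.mul_mem_mul h₂ (hm y (by simp))) (Ideal.mul_mem_mul h₃ (hm z (by simp))))

variable [IsScalarTower k R K] [IsFractionRing R K]

/-- As irreducible monomials have distinct values, a linear combination of irreducible monomials of
value less than `σ` has value less than `σ` unless it is trivial. -/
theorem IsJumpingSequence.eq_zero_of_mem_span (h : IsJumpingSequence k ν x y z P T β γ Z)
    (hk : ∀ c : k, c ≠ 0 → ν (algebraMap k K c) = 0)
    (hP : ∀ j, P j ≠ 0) (h0 : β 0 ≠ 0) {σ : ℚ} {f : R}
    (hf : f ∈ Submodule.span k (evalMon (Sum.elim P T) '' irredBelow β γ Z σ))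
    (hσ : (σ : WithTop ℚ) ≤ ν (algebraMap R K f)) : f = 0 := by
  classical
  obtain ⟨l, hl, rfl⟩ := (Finsupp.mem_span_image_iff_linearCombination k).1 hf
  by_contra hne
  have hl0 : l.support.Nonempty := by
    rw [Finsupp.support_nonempty_iff]
    rintro rfl
    exact hne (map_zero _)
  obtain ⟨M, hM, hmin⟩ := l.support.exists_min_image (weight (Sum.elim β γ)) hl0
  have hmem : ∀ N ∈ l.support, N ∈ irredBelow β γ Z σ := fun N hN =>
    (Finsupp.mem_supported k l).1 hl hN
  have hval : ∀ N ∈ l.support, ν (algebraMap R K (evalMon (Sum.elim P T) N)) =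
      (weight (Sum.elim β γ) N : WithTop ℚ) := by
    intro N hN
    obtain ⟨hN0, hNirr, -⟩ := hmem N hN
    refine map_evalMon h.elim_eq_val fun v hv => ?_
    rcases v with j | j
    · exact hP j
    · refine h.ne_zero_of_irred hP ((hNirr (j + 1)).of_le (N := single (Sum.inr j) 1) ?_)
        (fun i hi => ?_) (Sum.inr j) ?_
      · exact Finsupp.single_le_iff.2 (Nat.pos_of_ne_zero (Finsupp.mem_support_iff.1 hv))
      · have hij : i = j := by
          by_contra hij
          refine hi (Finsupp.single_eq_of_ne' ?_)
          exact fun h => hij (Sum.inr_injective h).symm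
        subst hij
        refine ⟨Nat.pos_of_ne_zero ?_, i.lt_succ_self⟩
        rintro rfl
        exact Finsupp.mem_support_iff.1 hv hN0
      · simp
  have hval' : ∀ N ∈ l.support, ν (algebraMap R K (l N • evalMon (Sum.elim P T) N)) =
      (weight (Sum.elim β γ) N : WithTop ℚ) := by
    intro N hN
    rw [Algebra.smul_def, map_mul, AddValuation.map_mul, ← IsScalarTower.algebraMap_apply,
      hk _ (Finsupp.mem_support_iff.1 hN), zero_add, hval N hN]
  have hsum : ν (algebraMap R K (Finsupp.linearCombination k (evalMon (Sum.elim P T)) l)) =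
      (weight (Sum.elim β γ) M : WithTop ℚ) := by
    rw [Finsupp.linearCombination_apply, Finsupp.sum, ← Finset.add_sum_erase _ _ hM, map_add,
      map_sum, ← hval' M hM]
    refine ν.map_add_eq_of_lt_left (ν.map_lt_sum ?_ fun N hN => ?_)
    · rw [hval' M hM]
      exact WithTop.coe_ne_top
    · obtain ⟨hNM, hN⟩ := Finset.mem_erase.1 hN
      rw [hval' M hM, hval' N hN]
      have hlt : weight (Sum.elim β γ) M < weight (Sum.elim β γ) N := by
        refine lt_of_le_of_ne (hmin N hN) fun heq => hNM ?_
        obtain ⟨h1, h2, -⟩ := hmem M hM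
        obtain ⟨h3, h4, -⟩ := hmem N hN
        exact (eq_of_weight_eq h0 h1 h3 h2 h4 heq).symm
      exact_mod_cast hlt
  rw [hsum] at hσ
  exact absurd (by exact_mod_cast hσ) (not_le.2 (hmem M hM).2.2)

variable [IsDomain R]

/-- Repeated rewriting expands each monomial: a rewriting step yields a monomial of the same value
that is lexicographically smaller, and a monomial of larger value. -/
theorem IsJumpingSequence.evalMon_mem_expansions (h : IsJumpingSequence k ν x y z P T β γ Z)
    (hP : ∀ j, P j ≠ 0) (h0 : β 0 ≠ 0) {σ : ℚ}
    (hwf : WellFounded fun a b : {ρ : ℚ // ρ ∈ valueSemigroup ν R ∧ ρ < σ} => b < a)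
    {M : Mon} (hM : M (Sum.inr 0) = 0) :
    evalMon (Sum.elim P T) M ∈ expansions k ν P T β γ Z σ := by
  have hval : ∀ {M : Mon}, evalMon (Sum.elim P T) M ≠ 0 →
      ν (algebraMap R K (evalMon (Sum.elim P T) M)) = (weight (Sum.elim β γ) M : WithTop ℚ) :=
    fun hne => map_evalMon h.elim_eq_val (ne_zero_of_evalMon_ne_zero hne)
  have hlarge : ∀ {M : Mon}, M (Sum.inr 0) = 0 → evalMon (Sum.elim P T) M ≠ 0 →
      σ ≤ weight (Sum.elim β γ) M → evalMon (Sum.elim P T) M ∈ expansions k ν P T β γ Z σ := by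
    intro M hM hne hσ
    refine Submodule.mem_sup_right (evalMon_mem_monomialIdeal hM ?_)
    rw [hval hne]
    exact_mod_cast hσ
  have key : ∀ a : {ρ : ℚ // ρ ∈ valueSemigroup ν R ∧ ρ < σ}, ∀ M : Mon, M (Sum.inr 0) = 0 →
      evalMon (Sum.elim P T) M ≠ 0 → weight (Sum.elim β γ) M = a →
      evalMon (Sum.elim P T) M ∈ expansions k ν P T β γ Z σ := by
    intro a
    induction a using hwf.induction with
    | _ a iha =>
    intro M
    induction M using wellFounded_monLT.induction with
    | _ M ihM =>
    intro hM hne hwM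
    by_cases hirr : ∀ j, Irred (TT β γ Z j) M
    · exact Submodule.mem_sup_left (Submodule.subset_span ⟨M, ⟨hM, hirr, hwM ▸ a.2.2⟩, rfl⟩)
    · rw [not_forall] at hirr
      obtain ⟨j, hj⟩ := hirr
      rw [Irred] at hj
      push Not at hj
      obtain ⟨b, hbM, hb⟩ := hj
      have hb0 : evalMon (Sum.elim P T) b ≠ 0 := by
        intro hb0
        rw [← evalMon_sub_mul _ hbM, hb0, mul_zero] at hne
        exact hne rfl
      obtain ⟨v, N, c, u, hr, hN0, hu0, heq, hlt⟩ := h.exists_reduction hP h0 hb hb0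
      have hMb0 : (M - b) (Sum.inr 0) = 0 := by
        rw [Finsupp.tsub_apply, hM, Nat.zero_sub]
      have hexp : evalMon (Sum.elim P T) M = c • evalMon (Sum.elim P T) (M - b + N) +
          evalMon (Sum.elim P T) (M - b + single u 1) := by
        rw [← evalMon_sub_mul _ hbM, heq, evalMon_add, evalMon_add, evalMon_single,
          Algebra.smul_def]
        ring
      rw [hexp]
      refine add_mem (Submodule.smul_mem _ _ ?_) ?_
      · by_cases hz : evalMon (Sum.elim P T) (M - b + N) = 0
        · rw [hz]
          exact zero_mem _
        · refine ihM _ (monLT_replace hbM hr.pos hr.eq_zero hr.lt) ?_ hz ?_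
          · rw [Finsupp.add_apply, hMb0, hN0]
          · rw [weight_add, hr.weight_eq, weight_sub_add _ hbM, hwM]
      · by_cases hz : evalMon (Sum.elim P T) (M - b + single u 1) = 0
        · rw [hz]
          exact zero_mem _
        · have hz0 : (M - b + single u 1 : Mon) (Sum.inr 0) = 0 := by
            rw [Finsupp.add_apply, hMb0, Finsupp.single_eq_of_ne' hu0, add_zero]
          have hu : Sum.elim P T u ≠ 0 := by
            intro hu
            rw [evalMon_add, evalMon_single, hu, pow_one, mul_zero] at hz
            exact hz rfl
          rw [map_eq_val hu, ← h.elim_eq_val] at hlt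
          have hlt' : weight (Sum.elim β γ) b < Sum.elim β γ u := by exact_mod_cast hlt
          have hgt : (a : ℚ) < weight (Sum.elim β γ) (M - b + single u 1) := by
            rw [← hwM, ← weight_sub_add _ hbM, weight_add, weight_single, one_nsmul]
            linarith
          by_cases hσ : σ ≤ weight (Sum.elim β γ) (M - b + single u 1)
          · exact hlarge hz0 hz hσ
          · exact iha ⟨_, ⟨_, hz, hval hz⟩, not_le.1 hσ⟩ hgt _ hz0 hz rfl
  by_cases hne : evalMon (Sum.elim P T) M = 0
  · rw [hne]
    exact zero_mem _
  · by_cases hσ : σ ≤ weight (Sum.elim β γ) M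
    · exact hlarge hM hne hσ
    · exact key ⟨_, ⟨_, hne, hval hne⟩, not_le.1 hσ⟩ M hM hne rfl

/-- The ideal of elements of value at least `σ` is generated by monomials. -/
theorem IsJumpingSequence.monomialIdeal_eq [IsLocalRing R] [IsNoetherianRing R]
    (h : IsJumpingSequence k ν x y z P T β γ Z) (hν : ∀ f : R, 0 ≤ ν (algebraMap R K f))
    (hk : ∀ c : k, c ≠ 0 → ν (algebraMap k K c) = 0)
    (hpos : ∀ f ∈ IsLocalRing.maximalIdeal R, 0 < ν (algebraMap R K f))
    (hres : ∀ f : R, ∃ c : k, f - algebraMap k R c ∈ IsLocalRing.maximalIdeal R)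
    (hxyz : IsLocalRing.maximalIdeal R = Ideal.span {x, y, z})
    (hP : ∀ j, P j ≠ 0) (h0 : β 0 ≠ 0) (σ : ℚ) :
    monomialIdeal ν (Sum.elim P fun i => T (i + 1)) σ = valueIdeal ν hν σ := by
  have hm : ∀ a ∈ ({x, y, z} : Set R), a ∈ IsLocalRing.maximalIdeal R := fun a ha =>
    hxyz ▸ Ideal.subset_span ha
  have hrad : IsLocalRing.maximalIdeal R ≤
      (monomialIdeal ν (Sum.elim P fun i => T (i + 1)) σ).radical := by
    have hvar : ∀ v, Sum.elim P (fun i => T (i + 1)) v ∈ IsLocalRing.maximalIdeal R →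
        Sum.elim P (fun i => T (i + 1)) v ∈
          (monomialIdeal ν (Sum.elim P fun i => T (i + 1)) σ).radical := fun v hv =>
      mem_monomialIdeal_pow (Sum.elim P fun i => T (i + 1)) v (hpos _ hv) σ
    have hx := hvar (Sum.inl 0)
    have hy := hvar (Sum.inl 1)
    have hz := hvar (Sum.inr 0)
    simp only [Sum.elim_inl, Sum.elim_inr, h.P_zero, h.P_one, zero_add, h.T_one] at hx hy hz
    conv_lhs => rw [hxyz]
    rw [Ideal.span_le]
    rintro a (rfl | rfl | rfl)
    exacts [hx (hm _ (by simp)), hy (hm _ (by simp)), hz (hm _ (by simp))]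
  obtain ⟨n, hn⟩ := Ideal.exists_pow_le_of_le_radical_of_fg hrad
    ((isNoetherianRing_iff_ideal_fg R).1 inferInstance _)
  have hwf := wellFounded_values hν (hn.trans (monomialIdeal_le _ hν σ))
  refine le_antisymm (monomialIdeal_le _ hν σ) fun f hf => ?_
  have hfW : f ∈ expansions k ν P T β γ Z σ := by
    obtain ⟨w, hw, hfw⟩ := exists_adjoin_sub_mem_pow hres hxyz n f
    rw [← sub_add_cancel f w]
    refine add_mem (Submodule.mem_sup_right (hn hfw)) ?_
    rw [← Subalgebra.mem_toSubmodule, Algebra.adjoin_eq_span] at hw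
    refine Submodule.span_le.2 ?_ hw
    intro g hg
    obtain ⟨M, hM, rfl⟩ : ∃ M : Mon, M (Sum.inr 0) = 0 ∧ evalMon (Sum.elim P T) M = g := by
      induction hg using Submonoid.closure_induction with
      | mem a ha =>
        rcases ha with rfl | rfl | rfl
        · exact ⟨single (Sum.inl 0) 1, by simp, by simp [evalMon_single, h.P_zero]⟩
        · exact ⟨single (Sum.inl 1) 1, by simp, by simp [evalMon_single, h.P_one]⟩
        · exact ⟨single (Sum.inr 1) 1, by simp, by simp [evalMon_single, h.T_one]⟩
      | one => exact ⟨0, rfl, evalMon_zero _⟩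
      | mul a b _ _ ha hb =>
        obtain ⟨M, hM, rfl⟩ := ha
        obtain ⟨N, hN, rfl⟩ := hb
        exact ⟨M + N, by rw [Finsupp.add_apply, hM, hN], evalMon_add _ _ _⟩
    exact h.evalMon_mem_expansions hP h0 hwf hM
  obtain ⟨w, hw, g, hg, rfl⟩ := Submodule.mem_sup.1 hfW
  have hg' : g ∈ monomialIdeal ν (Sum.elim P fun i => T (i + 1)) σ := hg
  have hwσ : w ∈ valueIdeal ν hν σ := by
    have := sub_mem hf (monomialIdeal_le _ hν σ hg')
    rwa [add_sub_cancel_right] at this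
  rw [h.eq_zero_of_mem_span hk hP h0 hw hwσ, zero_add]
  exact hg'

/-- The values of a generating sequence generate the value semigroup. -/
theorem valueSemigroup_eq_closure {ι : Type*} (Q : ι → R)
    (hν : ∀ f : R, 0 ≤ ν (algebraMap R K f)) (hQ : IsGeneratingSequence ν Q) :
    valueSemigroup ν R = (AddSubmonoid.closure (Set.range fun v => val ν (Q v)) : Set ℚ) := by
  set C := AddSubmonoid.closure (Set.range fun v => val ν (Q v)) with hC
  refine Set.Subset.antisymm ?_ ?_
  · rintro ρ ⟨f, hf0, hf⟩
    by_contra hρ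
    have hmem : f ∈ Ideal.span {g : R | ∃ b : ι →₀ ℕ, g = evalMon Q b ∧
        (ρ : WithTop ℚ) ≤ ν (algebraMap R K (evalMon Q b))} := by
      have h1 : f ∈ {f : R | (ρ : WithTop ℚ) ≤ ν (algebraMap R K f)} := hf.ge
      rwa [← hQ ρ ⟨f, hf0, hf⟩] at h1
    have hlt : (ρ : WithTop ℚ) < ν (algebraMap R K f) := by
      clear hf hf0
      induction hmem using Submodule.span_induction with
      | mem g hg =>
        obtain ⟨b, rfl, hb⟩ := hg
        refine lt_of_le_of_ne hb fun heq => hρ ?_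
        have hne : evalMon Q b ≠ 0 := by
          intro h0
          rw [h0, map_zero, AddValuation.map_zero] at heq
          exact WithTop.coe_ne_top heq
        rw [map_evalMon (w := fun v => val ν (Q v)) (fun _ => rfl)
          (ne_zero_of_evalMon_ne_zero hne)] at heq
        rw [WithTop.coe_injective heq]
        exact weight_mem _ C fun v _ => AddSubmonoid.subset_closure ⟨v, rfl⟩
      | zero => simp
      | add a b _ _ ha hb =>
        rw [map_add]
        exact ν.map_lt_add ha hb
      | smul c a _ ha =>
        rw [smul_eq_mul, map_mul, AddValuation.map_mul]
        exact ha.trans_le (le_add_of_nonneg_left (hν c))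
    rw [hf] at hlt
    exact lt_irrefl _ hlt
  · intro ρ hρ
    have hρ' : ρ ∈ C := hρ
    induction hρ' using AddSubmonoid.closure_induction with
    | mem a ha =>
      obtain ⟨v, rfl⟩ := ha
      by_cases hv : Q v = 0
      · refine ⟨1, one_ne_zero, ?_⟩
        simp only [hv, val_zero]
        simp
      · exact ⟨Q v, hv, map_eq_val hv⟩
    | zero => exact ⟨1, one_ne_zero, by simp⟩
    | add a b ha hb iha ihb =>
      obtain ⟨f, hf0, hf⟩ := iha ha
      obtain ⟨g, hg0, hg⟩ := ihb hb
      exact ⟨f * g, mul_ne_zero hf0 hg0, by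
        rw [map_mul, AddValuation.map_mul, hf, hg, WithTop.coe_add]⟩

end Expansion

theorem iSup_S_sup_iSup_U (β γ : ℕ → ℚ) : (⨆ i, S β i) ⊔ (⨆ i, U γ i) =
    AddSubmonoid.closure (Set.range β ∪ γ '' {i | 0 < i}) := by
  rw [AddSubmonoid.closure_union]
  refine le_antisymm (sup_le_sup (iSup_le fun i => ?_) (iSup_le fun i => ?_))
    (sup_le_sup (AddSubmonoid.closure_le.2 ?_) (AddSubmonoid.closure_le.2 ?_))
  · exact AddSubmonoid.closure_mono (Set.image_subset_range _ _)
  · exact AddSubmonoid.closure_mono (Set.image_mono fun _ hj => hj.1)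
  · rintro _ ⟨j, rfl⟩
    exact le_iSup (S β) j (mem_S β le_rfl)
  · rintro _ ⟨j, hj, rfl⟩
    exact le_iSup (U γ) j (mem_U γ hj le_rfl)

/-! ### Existence of jumping polynomials -/

/-- Recursive construction of a sequence whose `n`-th term has to satisfy a condition that involves
the terms up to the `n`-th. -/
theorem exists_seq {α : Type*} [Nonempty α] (C : (ℕ → α) → ℕ → Prop)
    (hloc : ∀ f g n, (∀ j ≤ n, f j = g j) → C f n → C g n)
    (hstep : ∀ f n, (∀ j < n, C f j) → ∃ a, C (Function.update f n a) n) : ∃ f, ∀ n, C f n := by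
  have hnext : ∀ n (f : {f : ℕ → α // ∀ j < n, C f j}), ∃ g : {f : ℕ → α // ∀ j < n + 1, C f j},
      ∀ j < n, g.1 j = f.1 j := by
    rintro n ⟨f, hf⟩
    obtain ⟨a, ha⟩ := hstep f n hf
    have hupd : ∀ j, j < n → Function.update f n a j = f j := fun j hj =>
      Function.update_of_ne hj.ne _ _
    refine ⟨⟨Function.update f n a, fun j hj => ?_⟩, hupd⟩
    rcases Nat.lt_succ_iff_lt_or_eq.1 hj with hj | rfl
    · exact hloc f _ j (fun l hl => (hupd l (hl.trans_lt hj)).symm) (hf j hj)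
    · exact ha
  choose next hnext using hnext
  let F : ∀ n, {f : ℕ → α // ∀ j < n, C f j} := fun n =>
    Nat.rec ⟨fun _ => Classical.arbitrary α, fun j hj => absurd hj (Nat.not_lt_zero j)⟩ next n
  have hF : ∀ n j, j < n → (F n).1 j = (F (j + 1)).1 j := by
    intro n
    induction n with
    | zero => exact fun j hj => absurd hj (Nat.not_lt_zero j)
    | succ n ih =>
      intro j hj
      rcases Nat.lt_succ_iff_lt_or_eq.1 hj with hj | rfl
      · rw [← ih j hj]
        exact hnext n (F n) j hj
      · rfl
  refine ⟨fun n => (F (n + 1)).1 n, fun n => ?_⟩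
  exact hloc _ _ n (fun j hj => hF (n + 1) j (Nat.lt_succ_of_le hj)) ((F (n + 1)).2 n n.lt_succ_self)

section Congr

variable {β β' γ γ' : ℕ → ℚ} {Z Z' : Set ℕ}

theorem G_congr {i : ℕ} (h : ∀ j ≤ i, β j = β' j) : G β i = G β' i := by
  have h' : β '' {j | j ≤ i} = β' '' {j | j ≤ i} := Set.image_congr fun j hj => h j hj
  rw [G, G, h']

theorem q_congr {i : ℕ} (h : ∀ j ≤ i, β j = β' j) : q β i = q β' i := by
  rw [q, q, G_congr (i := i - 1) fun j hj => h j (hj.trans (Nat.sub_le _ _)), h i le_rfl]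

theorem PP_congr {i : ℕ} (h : ∀ j ≤ i, β j = β' j) : PP β i = PP β' i := by
  ext M
  refine exists_congr fun j => and_congr_right fun _ => and_congr_right fun hj => ?_
  rw [q_congr fun l hl => h l (hl.trans hj.le)]

theorem H_congr {i : ℕ} (h : ∀ j, 0 < j → j ≤ i → γ j = γ' j) : H γ i = H γ' i := by
  have h' : γ '' {j | 1 ≤ j ∧ j ≤ i} = γ' '' {j | 1 ≤ j ∧ j ≤ i} :=
    Set.image_congr fun j hj => h j hj.1 hj.2
  rw [H, H, h']

theorem U_congr {i : ℕ} (h : ∀ j, 0 < j → j ≤ i → γ j = γ' j) : U γ i = U γ' i := by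
  have h' : γ '' {j | 1 ≤ j ∧ j ≤ i} = γ' '' {j | 1 ≤ j ∧ j ≤ i} :=
    Set.image_congr fun j hj => h j hj.1 hj.2
  rw [U, U, h']

theorem s_congr {i : ℕ} (hi : 0 < i) (h : ∀ j, 0 < j → j ≤ i → γ j = γ' j) :
    s β γ i = s β γ' i := by
  rw [s, s, H_congr (i := i - 1) fun j hj hji => h j hj (hji.trans (Nat.sub_le _ _)), h i hi le_rfl]

theorem m_congr (i : ℕ) : (∀ j, 0 < j → j ≤ i → γ j = γ' j) → m β γ i = m β γ' i := by
  induction i with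
  | zero => exact fun _ => rfl
  | succ i ih =>
    intro h
    rw [m, m, ih fun j hj hji => h j hj (hji.trans i.le_succ), s_congr i.succ_pos h,
      h (i + 1) i.succ_pos le_rfl, H_congr fun j hj hji => h j hj (hji.trans i.le_succ)]

theorem IsReduced.congr {ι : Type*} {Φ : AddSubmonoid ℚ} {w w' : ι → ℚ} {μ : ℚ} {a : ι →₀ ℕ} {c : ℕ}
    (h : ∀ v ∈ a.support, w v = w' v) (hr : IsReduced Φ w μ a c) : IsReduced Φ w' μ a c := by
  refine ⟨weight_congr h ▸ hr.1, fun b hb e he hec hlt => ?_⟩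
  rw [← weight_congr fun v hv => h v (Finsupp.support_mono hb hv)]
  exact hr.2 b hb e he hec hlt

theorem elim_congr {k i : ℕ} (h : ∀ j, 0 < j → j ≤ i → γ j = γ' j) {v : ℕ ⊕ ℕ} (hv : v ∈ vars k i) :
    Sum.elim β γ v = Sum.elim β γ' v := by
  rcases hv with ⟨j, -, rfl⟩ | ⟨j, hj, rfl⟩
  · rfl
  · exact h j hj.1 hj.2

theorem DD_congr {i : ℕ} (hi : 0 < i) (h : ∀ j, 0 < j → j ≤ i → γ j = γ' j) (X : Set Mon) :
    DD β γ i X = DD β γ' i X := by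
  have h' : ∀ j, 0 < j → j ≤ i - 1 → γ j = γ' j := fun j hj hji => h j hj (by omega)
  ext d
  simp only [DD, Set.mem_ofPred_eq, m_congr i h, s_congr hi h, h i hi le_rfl, U_congr h']
  refine and_congr_right fun hd => and_congr_right fun _ => and_congr_left fun _ => ⟨?_, ?_⟩
  · exact IsReduced.congr fun v hv => elim_congr h' (hd v hv)
  · exact IsReduced.congr fun v hv => (elim_congr h' (hd v hv)).symm

theorem lead_congr {i : ℕ} (hi : 0 < i) (h : ∀ j, 0 < j → j ≤ i → γ j = γ' j) (d : Mon × ℕ) :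
    lead β γ i d = lead β γ' i d := by
  rw [lead, lead, s_congr hi h]

theorem TT_congr (i : ℕ) : (∀ j, 0 < j → j < i → γ j = γ' j) →
    (∀ j, 0 < j → j < i → (j ∈ Z ↔ j ∈ Z')) → TT β γ Z i = TT β γ' Z' i := by
  induction i with
  | zero => exact fun _ _ => by rw [TT, TT]
  | succ i ih =>
    intro h hZ
    cases i with
    | zero => rw [TT, TT]
    | succ i =>
      have h' : ∀ j, 0 < j → j ≤ i + 1 → γ j = γ' j := fun j hj hji => h j hj (Nat.lt_succ_of_le hji)
      rw [TT, TT, ih (fun j hj hji => h j hj (hji.trans (Nat.lt_succ_self _)))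
        fun j hj hji => hZ j hj (hji.trans (Nat.lt_succ_self _)), DD_congr i.succ_pos h',
        show lead β γ (i + 1) = lead β γ' (i + 1) from funext (lead_congr i.succ_pos h')]
      congr 1
      classical exact if_congr (hZ (i + 1) i.succ_pos (Nat.lt_succ_self _)) rfl rfl

theorem D_congr {i : ℕ} (hi : 0 < i) (h : ∀ j, 0 < j → j ≤ i → γ j = γ' j)
    (hZ : ∀ j, 0 < j → j ≤ i → (j ∈ Z ↔ j ∈ Z')) : D β γ Z i = D β γ' Z' i := by
  rw [D, D, TT_congr i (fun j hj hji => h j hj hji.le) (fun j hj hji => hZ j hj hji.le),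
    DD_congr hi h]
  classical exact if_congr (hZ i hi le_rfl) rfl rfl

theorem δ_congr {i : ℕ} (h : ∀ j, 0 < j → j ≤ i → γ j = γ' j)
    (hZ : ∀ j, 0 < j → j ≤ i → (j ∈ Z ↔ j ∈ Z')) : δ β γ Z i = δ β γ' Z' i := by
  rcases Nat.eq_zero_or_pos i with rfl | hi
  · rw [δ, δ, if_pos rfl, if_pos rfl]
  · rw [δ, δ, D_congr hi h hZ]

theorem support_lead {i : ℕ} (hi : 0 < i) {d : Mon × ℕ} (hd : d ∈ D β γ Z i) :
    ∀ v ∈ (lead β γ i d).support, v ∈ vars (m β γ i) i :=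
  support_add_subset (fun v hv => vars_mono le_rfl (Nat.sub_le _ _)
    ((mem_DD_of_mem_D hd).2.1 v hv)) (support_single_subset (inr_mem_vars.2 ⟨hi, le_rfl⟩))

end Congr

section Existence

variable {k K R : Type*} [Field k] [Field K] [Algebra k K] [CommRing R] [Algebra k R] [Algebra R K]

theorem IsNextP.congr {ν : AddValuation K (WithTop ℚ)} {P P' T T' : ℕ → R} {β β' γ γ' : ℕ → ℚ}
    {i : ℕ} {a : R} (hP : ∀ j ≤ i, P j = P' j) (hβ : ∀ j ≤ i, β j = β' j)
    (h : IsNextP k ν P T β γ i a) : IsNextP k ν P' T' β' γ' i a := by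
  obtain ⟨n, lam, hn, hw, hirr, hres, ha⟩ := h
  have hev : evalMon (Sum.elim P T) n = evalMon (Sum.elim P' T') n := by
    refine evalMon_congr _ fun v hv => ?_
    obtain ⟨j, hj, rfl⟩ := hn v hv
    exact hP j (le_of_lt hj)
  have hwt : weight (Sum.elim β γ) n = weight (Sum.elim β' γ') n := by
    refine weight_congr fun v hv => ?_
    obtain ⟨j, hj, rfl⟩ := hn v hv
    exact hβ j (le_of_lt hj)
  rw [q_congr hβ, hP i le_rfl, hev] at hres ha
  rw [q_congr hβ, hβ i le_rfl, hwt] at hw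
  rw [PP_congr hβ] at hirr
  exact ⟨n, lam, hn, hw, hirr, hres, ha⟩

/-- `a` is a possible choice for the successor of `T_i` that corresponds to `d ∈ 𝒟_i`. -/
def IsNextT (k : Type*) {R K : Type*} [Field k] [CommRing R] [Field K] [Algebra k R] [Algebra R K]
    [Algebra k K] (ν : AddValuation K (WithTop ℚ)) (P T : ℕ → R) (β γ : ℕ → ℚ) (Z : Set ℕ) (i : ℕ)
    (d : Mon × ℕ) (a : R) : Prop :=
  ∃ (n : Mon) (mu : k),
    (∀ v ∈ n.support, v ∈ vars (m β γ i) (i - 1)) ∧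
    weight (Sum.elim β γ) (lead β γ i d) = weight (Sum.elim β γ) n ∧
    Irred (TT β γ Z i) n ∧
    IsResidue ν (evalMon (Sum.elim P T) (lead β γ i d)) (evalMon (Sum.elim P T) n) mu ∧
    a = evalMon (Sum.elim P T) (lead β γ i d) - algebraMap k R mu * evalMon (Sum.elim P T) n

theorem IsNextT.congr {ν : AddValuation K (WithTop ℚ)} {P T T' : ℕ → R} {β γ γ' : ℕ → ℚ}
    {Z Z' : Set ℕ} {i : ℕ} {d : Mon × ℕ} {a : R} (hi : 0 < i) (hd : d ∈ D β γ Z i)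
    (hT : ∀ j, 0 < j → j ≤ i → T j = T' j) (hγ : ∀ j, 0 < j → j ≤ i → γ j = γ' j)
    (hZ : ∀ j, 0 < j → j ≤ i → (j ∈ Z ↔ j ∈ Z'))
    (h : IsNextT k ν P T β γ Z i d a) : IsNextT k ν P T' β γ' Z' i d a := by
  obtain ⟨n, mu, hn, hw, hirr, hres, ha⟩ := h
  have hnV : ∀ v ∈ n.support, v ∈ vars (m β γ i) i := fun v hv =>
    vars_mono le_rfl (Nat.sub_le _ _) (hn v hv)
  have hev : ∀ a : Mon, (∀ v ∈ a.support, v ∈ vars (m β γ i) i) →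
      evalMon (Sum.elim P T) a = evalMon (Sum.elim P T') a := by
    intro a ha
    refine evalMon_congr _ fun v hv => ?_
    rcases ha v hv with ⟨j, -, rfl⟩ | ⟨j, hj, rfl⟩
    · rfl
    · exact hT j hj.1 hj.2
  have hwt : ∀ a : Mon, (∀ v ∈ a.support, v ∈ vars (m β γ i) i) →
      weight (Sum.elim β γ) a = weight (Sum.elim β γ') a := fun a ha =>
    weight_congr fun v hv => elim_congr hγ (ha v hv)
  have hl := support_lead hi hd
  rw [hev _ hl, hev _ hnV, lead_congr hi hγ] at hres ha
  rw [hwt _ hl, hwt _ hnV, lead_congr hi hγ] at hw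
  rw [m_congr i hγ] at hn
  rw [TT_congr i (fun j hj hji => hγ j hj hji.le) fun j hj hji => hZ j hj hji.le] at hirr
  exact ⟨n, mu, hn, hw, hirr, hres, ha⟩

/-- `E` restricts to an enumeration of `D` by `{0, …, n - 1}` along which `w` is increasing. -/
def IsSortedEnum {α : Type*} (n : ℕ) (D : Set α) (w : α → ℚ) (E : ℕ → α) : Prop :=
  ∃ e : Fin n ≃ D, (∀ t, (e t : α) = E t) ∧ Monotone fun t => w (e t)

theorem IsSortedEnum.congr {α : Type*} {n : ℕ} {D : Set α} {w w' : α → ℚ} {E : ℕ → α}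
    (h : IsSortedEnum n D w E) (hw : ∀ d ∈ D, w d = w' d) : IsSortedEnum n D w' E := by
  obtain ⟨e, he, hmono⟩ := h
  refine ⟨e, he, fun a b hab => ?_⟩
  simp only [← hw _ (e a).2, ← hw _ (e b).2]
  exact hmono hab

theorem exists_isSortedEnum {α : Type*} [Nonempty α] {D : Set α} (hD : D.Finite) (w : α → ℚ) :
    ∃ E, IsSortedEnum D.ncard D w E := by
  classical
  have := hD.to_subtype
  have e₀ : Fin D.ncard ≃ D := by
    rw [← Nat.card_coe_set_eq]
    exact (Finite.equivFin D).symm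
  let e : Fin D.ncard ≃ D := (Tuple.sort fun t => w (e₀ t)).trans e₀
  refine ⟨fun t => if h : t < D.ncard then e ⟨t, h⟩ else Classical.arbitrary α, e, fun t => ?_, ?_⟩
  · simp
  · exact Tuple.monotone_sort fun t => w (e₀ t)

variable [IsAlgClosed k] [IsFractionRing R K] {ν : AddValuation K (WithTop ℚ)}

theorem exists_isNextP (hk : ∀ c : k, c ≠ 0 → ν (algebraMap k K c) = 0)
    (hzero : IsZeroDimensional k ν) (P T : ℕ → R) (β γ : ℕ → ℚ) (hβ : ∀ i, β i = val ν (P i)) (i : ℕ)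
    (hi : 0 < i) (hP : ∀ j ≤ i, P j ≠ 0 ∧ 0 < β j)
    (hlt : ∀ j, 1 ≤ j → j < i → q β j • β j < β (j + 1)) : ∃ a, IsNextP k ν P T β γ i a := by
  obtain ⟨l, rfl⟩ := Nat.exists_eq_add_of_le' hi
  have h0 : 0 < β 0 := (hP 0 (Nat.zero_le _)).2
  have hqS : ∀ j, j ≤ l → q β (j + 1) • β (j + 1) ∈ S β j := fun j hj =>
    q_smul_mem_S h0 j (fun t ht => (hP t (by omega)).2.le) fun t ht htj => hlt t ht (by omega)
  obtain ⟨M, hM, hMw⟩ := exists_weight_eq_inl γ (hqS l le_rfl)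
  obtain ⟨N, hN, hNw, hirr⟩ := exists_irred (Sum.elim β γ) (PP β (l + 1)) (Sum.inl '' {j | j ≤ l})
    (by
      rintro _ ⟨j, hj, hjl, rfl⟩ -
      obtain ⟨t, rfl⟩ := Nat.exists_eq_add_of_le' hj
      obtain ⟨N, hN, hw⟩ := exists_weight_eq_inl γ (hqS t (by omega))
      refine ⟨Sum.inl (t + 1), N, ⟨?_, fun u hu => ?_, fun u hu => ?_, ?_⟩, fun u hu => ?_⟩
      · rw [Finsupp.single_eq_same]
        exact (q_spec h0.ne' _).1
      · refine Finsupp.single_eq_of_ne' ?_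
        rintro rfl
        exact irrefl_of VarLT _ hu
      · obtain ⟨s, hs, rfl⟩ := hN u hu
        exact Sum.Lex.inl (Nat.lt_succ_of_le hs)
      · rw [hw, weight_single]
        rfl
      · obtain ⟨s, hs, rfl⟩ := hN u hu
        have hs' : s ≤ t := hs
        exact ⟨s, show s ≤ l by omega, rfl⟩) M hM
  have hNne : ∀ v ∈ N.support, Sum.elim P T v ≠ 0 := by
    intro v hv
    obtain ⟨j, hj, rfl⟩ := hN v hv
    exact (hP j (le_trans hj l.le_succ)).1
  have hwt : weight (fun v => val ν (Sum.elim P T v)) N = weight (Sum.elim β γ) N := by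
    refine weight_congr fun v hv => ?_
    obtain ⟨j, hj, rfl⟩ := hN v hv
    exact (hβ j).symm
  obtain ⟨lam, hlam⟩ := exists_isResidue hk hzero (f := P (l + 1) ^ q β (l + 1))
    (g := evalMon (Sum.elim P T) N) fun _ _ => by
      rw [map_evalMon (w := fun v => val ν (Sum.elim P T v)) (fun _ => rfl) hNne, map_pow,
        AddValuation.map_pow, map_eq_val (hP (l + 1) le_rfl).1, ← WithTop.coe_nsmul, hwt, hNw, hMw,
        ← hβ]
  refine ⟨_, N, lam, fun v hv => ?_, (hNw.trans hMw).symm, hirr, hlam, rfl⟩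
  obtain ⟨j, hj, rfl⟩ := hN v hv
  exact ⟨j, Nat.lt_succ_of_le hj, rfl⟩

theorem exists_isNextT (hk : ∀ c : k, c ≠ 0 → ν (algebraMap k K c) = 0)
    (hzero : IsZeroDimensional k ν) (P T : ℕ → R) (β γ : ℕ → ℚ) (Z : Set ℕ)
    (hβ : ∀ i, β i = val ν (P i)) (hγ : ∀ i, γ i = val ν (T i)) (hZ : ∀ i, i ∈ Z ↔ T i = 0)
    (h0 : 0 < β 0) (hqS : ∀ j, 0 < j → q β j • β j ∈ S β (j - 1)) (i : ℕ) {d : Mon × ℕ}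
    (hd : d ∈ D β γ Z i) : ∃ a, IsNextT k ν P T β γ Z i d a := by
  have hw : ∀ v, Sum.elim β γ v = val ν (Sum.elim P T v) := by
    rintro (v | v)
    exacts [hβ v, hγ v]
  have hmem := (mem_DD_of_mem_D hd).2.2.2.1.1
  rw [← weight_lead] at hmem
  obtain ⟨N, hN, hNw, hirr⟩ := exists_irred_TT (Z := Z) h0
    (fun j hj => by rw [hγ, (hZ j).1 hj, val_zero]) hqS
    (fun j hj => m_mono γ hj.le) hmem
  obtain ⟨mu, hmu⟩ := exists_isResidue hk hzero (f := evalMon (Sum.elim P T) (lead β γ i d))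
    (g := evalMon (Sum.elim P T) N) fun h1 h2 => by
      rw [map_evalMon hw (ne_zero_of_evalMon_ne_zero h1),
        map_evalMon hw (ne_zero_of_evalMon_ne_zero h2), hNw]
  exact ⟨_, N, mu, hN, hNw.symm, hirr, hmu, rfl⟩

end Existence

section Construction

variable {k K R : Type*} [Field k] [Field K] [Algebra k K] [CommRing R] [Algebra k R] [Algebra R K]
  {ν : AddValuation K (WithTop ℚ)} {x y z : R}

/-- The conditions on the term `T_n` and the enumeration of `𝒟_n` in the construction of the
polynomials `T_i`. The sequence `F` consists of these polynomials and of enumerations of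
the sets `𝒟_i`. -/
structure IsTStep (k : Type*) {R K : Type*} [Field k] [CommRing R] [Field K] [Algebra k R]
    [Algebra R K] [Algebra k K] (ν : AddValuation K (WithTop ℚ)) (z : R) (P : ℕ → R) (β : ℕ → ℚ)
    (F : ℕ → R × (ℕ → Mon × ℕ)) (T : ℕ → R) (γ : ℕ → ℚ) (Z : Set ℕ) (n : ℕ) : Prop where
  one : n = 1 → T n = z
  rest : 0 < n → (∑ l ∈ Finset.range n, δ β γ Z l) < n → T n = 0
  succ : ∀ i t, 0 < i → i < n → t < δ β γ Z i →
    n = (∑ l ∈ Finset.range i, δ β γ Z l) + (t + 1) →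
    IsNextT k ν P T β γ Z i ((F i).2 t) (T n)
  enum : 0 < n → IsSortedEnum (δ β γ Z n) (D β γ Z n)
    (fun d => weight (Sum.elim β γ) (lead β γ n d)) (F n).2

theorem IsSortedEnum.mem {α : Type*} {n : ℕ} {D : Set α} {w : α → ℚ} {E : ℕ → α}
    (h : IsSortedEnum n D w E) {t : ℕ} (ht : t < n) : E t ∈ D := by
  obtain ⟨e, he, -⟩ := h
  rw [← he ⟨t, ht⟩]
  exact (e ⟨t, ht⟩).2

/-- Only the terms up to the `n`-th matter for the conditions on the `n`-th term, provided that the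
earlier terms are enumerated correctly. -/
theorem IsTStep.congr {P : ℕ → R} {β : ℕ → ℚ} {F F' : ℕ → R × (ℕ → Mon × ℕ)} {T T' : ℕ → R}
    {γ γ' : ℕ → ℚ} {Z Z' : Set ℕ} {n : ℕ} (hγ : ∀ i, γ i = val ν (T i))
    (hγ' : ∀ i, γ' i = val ν (T' i)) (hZ : ∀ i, i ∈ Z ↔ T i = 0) (hZ' : ∀ i, i ∈ Z' ↔ T' i = 0)
    (hT : ∀ j ≤ n, T j = T' j) (hF : ∀ j ≤ n, (F j).2 = (F' j).2)
    (henum : ∀ i, 0 < i → i < n → ∀ t < δ β γ Z i, (F i).2 t ∈ D β γ Z i)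
    (h : IsTStep k ν z P β F T γ Z n) : IsTStep k ν z P β F' T' γ' Z' n := by
  have hγγ : ∀ i ≤ n, ∀ j, 0 < j → j ≤ i → γ j = γ' j := fun i hi j _ hji => by
    rw [hγ, hγ', hT j (hji.trans hi)]
  have hZZ : ∀ i ≤ n, ∀ j, 0 < j → j ≤ i → (j ∈ Z ↔ j ∈ Z') := fun i hi j _ hji => by
    rw [hZ, hZ', hT j (hji.trans hi)]
  have hδ : ∀ i ≤ n, δ β γ Z i = δ β γ' Z' i := fun i hi => δ_congr (hγγ i hi) (hZZ i hi)
  have hsum : ∀ i ≤ n, ∑ l ∈ Finset.range i, δ β γ Z l = ∑ l ∈ Finset.range i, δ β γ' Z' l :=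
    fun i hi => Finset.sum_congr rfl fun l hl => hδ l ((Finset.mem_range.1 hl).le.trans hi)
  refine ⟨fun hn => ?_, fun hn hlt => ?_, fun i t hi hin ht hn => ?_, fun hn => ?_⟩
  · rw [← hT n le_rfl, h.one hn]
  · rw [← hsum n le_rfl] at hlt
    rw [← hT n le_rfl, h.rest hn hlt]
  · rw [← hδ i hin.le] at ht
    rw [← hsum i hin.le] at hn
    rw [← hT n le_rfl, ← hF i hin.le]
    exact (h.succ i t hi hin ht hn).congr hi (henum i hi hin t ht)
      (fun j _ hji => hT j (hji.trans hin.le)) (hγγ i hin.le) (hZZ i hin.le)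
  · rw [← hδ n le_rfl, ← D_congr hn (hγγ n le_rfl) (hZZ n le_rfl), ← hF n le_rfl]
    refine (h.enum hn).congr fun d hd => ?_
    rw [← lead_congr hn (hγγ n le_rfl)]
    exact weight_congr fun v hv => elim_congr (hγγ n le_rfl) (support_lead hn hd v hv)

variable [IsAlgClosed k] [IsFractionRing R K]

theorem exists_P [IsDomain R] [IsScalarTower k R K]
    (hk : ∀ c : k, c ≠ 0 → ν (algebraMap k K c) = 0) (hzero : IsZeroDimensional k ν)
    (hx : x ≠ 0) (hxpos : 0 < val ν x) (hypos : 0 < val ν y) (hxy : ∀ n, ¬ x ∣ y ^ n) :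
    ∃ P : ℕ → R, P 0 = x ∧ P 1 = y ∧
      ∀ i, 0 < i → IsNextP k ν P 0 (fun i => val ν (P i)) 0 i (P (i + 1)) := by
  refine (exists_seq (α := R) (fun P n => (n = 0 → P n = x) ∧ (n = 1 → P n = y) ∧
    ∀ i, 0 < i → n = i + 1 → IsNextP k ν P 0 (fun i => val ν (P i)) 0 i (P n)) ?_ ?_).imp
      fun P hP => ?_
  · rintro P P' n h ⟨h0, h1, h2⟩
    rw [h n le_rfl] at h0 h1
    refine ⟨h0, h1, fun i hi hn => ?_⟩
    rw [← h n le_rfl]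
    have hji : ∀ j ≤ i, P j = P' j := fun j hj => h j (by omega)
    exact (h2 i hi hn).congr hji fun j hj => by rw [hji j hj]
  · intro P n ih
    rcases n with _ | _ | n
    · exact ⟨x, by simp, by simp, by simp⟩
    · refine ⟨y, by simp, by simp, fun i hi hn => by omega⟩
    · have hprop := P_properties (k := k) (T := 0) (γ := 0) hx hxpos hypos hxy
        ((ih 0 (by omega)).1 rfl) ((ih 1 (by omega)).2.1 rfl) (fun _ => rfl) (n + 1)
        fun i hi hin => (ih (i + 1) (by omega)).2.2 i hi rfl
      obtain ⟨a, ha⟩ := exists_isNextP hk hzero P 0 _ 0 (fun _ => rfl) (n + 1) n.succ_pos hprop.1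
        hprop.2.2
      refine ⟨a, by simp, by simp, fun i hi hn => ?_⟩
      obtain rfl : i = n + 1 := by omega
      have hupd : ∀ j ≤ n + 1, P j = Function.update P (n + 1 + 1) a j := fun j hj =>
        (Function.update_of_ne (by omega) _ _).symm
      rw [Function.update_self]
      exact ha.congr hupd fun j hj => by rw [← hupd j hj]
  · exact ⟨(hP 0).1 rfl, (hP 1).2.1 rfl, fun i hi => (hP (i + 1)).2.2 i hi rfl⟩

theorem exists_T (hk : ∀ c : k, c ≠ 0 → ν (algebraMap k K c) = 0) (hzero : IsZeroDimensional k ν)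
    (z : R) (P : ℕ → R) (β : ℕ → ℚ) (hβ : ∀ i, β i = val ν (P i)) (h0 : 0 < β 0)
    (hqS : ∀ j, 0 < j → q β j • β j ∈ S β (j - 1)) :
    ∃ F : ℕ → R × (ℕ → Mon × ℕ), ∀ n, IsTStep k ν z P β F (fun i => (F i).1)
      (fun i => val ν (F i).1) {i | (F i).1 = 0} n := by
  have : Nonempty (R × (ℕ → Mon × ℕ)) := ⟨(0, fun _ => (0, 0))⟩
  -- The membership of the enumerated tuples in `𝒟_i` is carried along, as `IsTStep.congr` needs it.
  refine (exists_seq (fun (F : ℕ → R × (ℕ → Mon × ℕ)) n =>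
    (∀ i, 0 < i → i < n → ∀ t < δ β (fun i => val ν (F i).1) {i | (F i).1 = 0} i,
      (F i).2 t ∈ D β (fun i => val ν (F i).1) {i | (F i).1 = 0} i) ∧
    IsTStep k ν z P β F (fun i => (F i).1) (fun i => val ν (F i).1) {i | (F i).1 = 0} n) ?_ ?_).imp
      fun F hF n => (hF n).2
  · rintro F F' n h ⟨hmem, hstep⟩
    refine ⟨fun i hi hin t ht => ?_, hstep.congr (fun _ => rfl) (fun _ => rfl) (fun _ => Iff.rfl)
      (fun _ => Iff.rfl) (fun j hj => by rw [h j hj]) (fun j hj => by rw [h j hj]) hmem⟩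
    have hγ : ∀ j, 0 < j → j ≤ i → val ν (F j).1 = val ν (F' j).1 := fun j _ hj => by
      rw [h j (hj.trans hin.le)]
    have hZ : ∀ j, 0 < j → j ≤ i → (j ∈ {i | (F i).1 = 0} ↔ j ∈ {i | (F' i).1 = 0}) :=
      fun j _ hj => by
        rw [Set.mem_ofPred_eq, Set.mem_ofPred_eq, h j (hj.trans hin.le)]
    rw [← δ_congr hγ hZ] at ht
    rw [← D_congr hi hγ hZ, ← h i hin.le]
    exact hmem i hi hin t ht
  · intro F n ih
    have hmem : ∀ i, 0 < i → i < n → ∀ t < δ β (fun i => val ν (F i).1) {i | (F i).1 = 0} i,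
        (F i).2 t ∈ D β (fun i => val ν (F i).1) {i | (F i).1 = 0} i := fun i hi hin t ht =>
      ((ih i hin).2.enum hi).mem ht
    -- The value of `T_n`.
    obtain ⟨a, ha1, ha2, ha3⟩ : ∃ a : R, (n = 1 → a = z) ∧
        (0 < n → (∑ l ∈ Finset.range n, δ β (fun i => val ν (F i).1) {i | (F i).1 = 0} l) < n →
          a = 0) ∧
        ∀ i t, 0 < i → i < n → t < δ β (fun i => val ν (F i).1) {i | (F i).1 = 0} i →
          n = (∑ l ∈ Finset.range i, δ β (fun i => val ν (F i).1) {i | (F i).1 = 0} l) + (t + 1) →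
          IsNextT k ν P (fun i => (F i).1) β (fun i => val ν (F i).1) {i | (F i).1 = 0} i
            ((F i).2 t) a := by
      set dl : ℕ → ℕ := δ β (fun i => val ν (F i).1) {i | (F i).1 = 0} with hdl
      have hmono : ∀ i j, i < j → (∑ l ∈ Finset.range i, dl l) + dl i ≤
          ∑ l ∈ Finset.range j, dl l := by
        intro i j hij
        rw [← Finset.sum_range_succ]
        exact Finset.sum_le_sum_of_subset (Finset.range_mono hij)
      by_cases hex : ∃ i t, 0 < i ∧ i < n ∧ t < dl i ∧ n = (∑ l ∈ Finset.range i, dl l) + (t + 1)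
      · obtain ⟨i, t, hi, hin, ht, hn⟩ := hex
        obtain ⟨a, ha⟩ := exists_isNextT hk hzero P (fun i => (F i).1) β (fun i => val ν (F i).1)
          {i | (F i).1 = 0} hβ (fun _ => rfl) (fun _ => Iff.rfl) h0 hqS i (hmem i hi hin t ht)
        refine ⟨a, fun hn1 => by omega, fun _ hlt => ?_, fun i' t' hi' hin' ht' hn' => ?_⟩
        · have := hmono i n hin
          omega
        · have hii : i = i' := by
            rcases lt_trichotomy i i' with h | h | h
            · have := hmono i i' h
              omega
            · exact h
            · have := hmono i' i h
              omega
          subst hii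
          have htt : t = t' := by omega
          subst htt
          exact ha
      · refine ⟨if n = 1 then z else 0, fun hn => if_pos hn, fun _ hlt => if_neg ?_,
          fun i t hi hin ht hn => absurd ⟨i, t, hi, hin, ht, hn⟩ hex⟩
        rintro rfl
        rw [Finset.sum_range_one, hdl, δ, if_pos rfl] at hlt
        exact lt_irrefl _ hlt
    -- The enumeration of `𝒟_n`, which depends on `T_n`.
    obtain ⟨E, hE⟩ := exists_isSortedEnum (D_finite (β := β)
      (γ := fun i => val ν (Function.update (fun i => (F i).1) n a i))
      (Z := {i | Function.update (fun i => (F i).1) n a i = 0}) n)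
      fun d => weight (Sum.elim β fun i => val ν (Function.update (fun i => (F i).1) n a i))
        (lead β (fun i => val ν (Function.update (fun i => (F i).1) n a i)) n d)
    have hfst : (fun i => (Function.update F n (a, E) i).1) =
        Function.update (fun i => (F i).1) n a := by
      funext i
      by_cases hi : i = n
      · subst hi
        simp
      · simp [hi]
    have hfst' : ∀ i, (Function.update F n (a, E) i).1 = Function.update (fun i => (F i).1) n a i :=
      congrFun hfst
    have hlt : ∀ j < n, Function.update F n (a, E) j = F j := fun j hj =>
      Function.update_of_ne hj.ne _ _
    have hγ : ∀ i < n, ∀ j, 0 < j → j ≤ i → val ν (F j).1 =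
        val ν (Function.update F n (a, E) j).1 := fun i hi j _ hj => by
      rw [hlt j (hj.trans_lt hi)]
    have hZ : ∀ i < n, ∀ j, 0 < j → j ≤ i →
        (j ∈ {i | (F i).1 = 0} ↔ j ∈ {i | (Function.update F n (a, E) i).1 = 0}) :=
      fun i hi j _ hj => by
        rw [Set.mem_ofPred_eq, Set.mem_ofPred_eq, hlt j (hj.trans_lt hi)]
    have hδ : ∀ i < n, δ β (fun i => val ν (F i).1) {i | (F i).1 = 0} i =
        δ β (fun i => val ν (Function.update F n (a, E) i).1)
          {i | (Function.update F n (a, E) i).1 = 0} i := fun i hi => δ_congr (hγ i hi) (hZ i hi)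
    have hsum : ∀ i ≤ n, ∑ l ∈ Finset.range i, δ β (fun i => val ν (F i).1) {i | (F i).1 = 0} l =
        ∑ l ∈ Finset.range i, δ β (fun i => val ν (Function.update F n (a, E) i).1)
          {i | (Function.update F n (a, E) i).1 = 0} l := fun i hi =>
      Finset.sum_congr rfl fun l hl => hδ l ((Finset.mem_range.1 hl).trans_le hi)
    refine ⟨(a, E), fun i hi hin t ht => ?_, fun hn => ?_, fun hn hs => ?_,
      fun i t hi hin ht hn => ?_, fun hn => ?_⟩
    · rw [← hδ i hin] at ht
      rw [← D_congr hi (hγ i hin) (hZ i hin), hlt i hin]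
      exact hmem i hi hin t ht
    · simp only [Function.update_self]
      exact ha1 hn
    · simp only [Function.update_self]
      rw [← hsum n le_rfl] at hs
      exact ha2 hn hs
    · rw [← hδ i hin] at ht
      rw [← hsum i hin.le] at hn
      rw [hlt i hin]
      simp only [Function.update_self]
      exact (ha3 i t hi hin ht hn).congr hi (hmem i hi hin t ht)
        (fun j _ hj => by rw [hlt j (hj.trans_lt hin)]) (hγ i hin) (hZ i hin)
    · simp only [hfst', Function.update_self]
      have hδn : ∀ (γ : ℕ → ℚ) (Z : Set ℕ), δ β γ Z n = (D β γ Z n).ncard := fun γ Z => by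
        rw [δ, if_neg hn.ne']
      rw [hδn]
      exact hE

/-- The construction of jumping polynomials can be carried out. -/
theorem exists_isJumpingSequence [IsDomain R] [IsScalarTower k R K]
    (hk : ∀ c : k, c ≠ 0 → ν (algebraMap k K c) = 0) (hzero : IsZeroDimensional k ν)
    (hx : x ≠ 0) (hxpos : 0 < val ν x) (hypos : 0 < val ν y) (hxy : ∀ n, ¬ x ∣ y ^ n) (z : R) :
    ∃ (P T : ℕ → R) (β γ : ℕ → ℚ) (Z : Set ℕ), IsJumpingSequence k ν x y z P T β γ Z := by
  obtain ⟨P, hP0, hP1, hP⟩ := exists_P hk hzero hx hxpos hypos hxy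
  have hprop := fun n => P_properties (k := k) (T := 0) (γ := 0) hx hxpos hypos hxy hP0 hP1
    (fun _ => rfl) n fun i hi _ => hP i hi
  have h0 : 0 < val ν (P 0) := ((hprop 0).1 0 le_rfl).2
  have hqS : ∀ j, 0 < j → q (fun i => val ν (P i)) j • val ν (P j) ∈
      S (fun i => val ν (P i)) (j - 1) := by
    intro j hj
    obtain ⟨l, rfl⟩ := Nat.exists_eq_add_of_le' hj
    exact q_smul_mem_S (β := fun i => val ν (P i)) h0 l (fun t ht => ((hprop t).1 t le_rfl).2.le)
      fun t ht htl => (hprop (t + 1)).2.2 t ht t.lt_succ_self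
  obtain ⟨F, hF⟩ := exists_T hk hzero z P (fun i => val ν (P i)) (fun _ => rfl) h0 hqS
  refine ⟨P, fun i => (F i).1, fun i => val ν (P i), fun i => val ν (F i).1, {i | (F i).1 = 0},
    fun _ => rfl, fun _ => rfl, fun _ => Iff.rfl, hP0, hP1, fun i hi => ?_, (hF 1).one rfl,
    fun i hi hTi => ?_, fun j hj => (hF j).rest hj⟩
  · exact (hP i hi).congr (fun _ _ => rfl) fun _ _ => rfl
  · obtain ⟨e, he, hmono⟩ := (hF i).enum hi
    refine ⟨e, hmono, fun t => ?_⟩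
    rw [he t]
    have hle : i ≤ ∑ l ∈ Finset.range i, δ (fun i => val ν (P i)) (fun i => val ν (F i).1)
        {i | (F i).1 = 0} l := by
      by_contra hlt
      exact hTi ((hF i).rest hi (not_le.1 hlt))
    exact (hF _).succ i t hi (by omega) t.2 rfl

end Construction

end JumpingPolynomials

theorem theorem4p8 {k K R : Type*} [Field k] [IsAlgClosed k] [Field K] [Algebra k K]
    -- `K` is an algebraic function field of transcendence degree 3 over `k`
    (hfg : (⊤ : IntermediateField k K).FG) (htr : Algebra.trdeg k K = 3)
    -- `R` is a regular local ring with `k ⊆ R ⊆ K` and fraction field `K`,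
    -- with regular parameters `x, y, z`
    [CommRing R] [IsDomain R] [IsRegularLocalRing R] [Algebra k R] [Algebra R K]
    [IsScalarTower k R K] [IsFractionRing R K] (hdim : ringKrullDim R = 3)
    (x y z : R) (hxyz : IsLocalRing.maximalIdeal R = Ideal.span {x, y, z})
    -- `ν` is a zero-dimensional `k`-valuation of `K` with value group in `ℚ` that dominates `R`
    (ν : AddValuation K (WithTop ℚ)) (hk : ∀ c : k, c ≠ 0 → ν (algebraMap k K c) = 0)
    (hzero : JumpingPolynomials.IsZeroDimensional k ν)
    (hdom : JumpingPolynomials.Dominates ν R) :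
    -- the construction of jumping polynomials can be carried out
    (∃ (P T : ℕ → R) (β γ : ℕ → ℚ) (Z : Set ℕ),
      JumpingPolynomials.IsJumpingSequence k ν x y z P T β γ Z) ∧
    -- and whenever `P_0, P_1, …, T_1, T_2, …` are constructed in this way:
    ∀ (P T : ℕ → R) (β γ : ℕ → ℚ) (Z : Set ℕ),
      JumpingPolynomials.IsJumpingSequence k ν x y z P T β γ Z →
      -- they form a generating sequence of `ν` in `R`,
      JumpingPolynomials.IsGeneratingSequence ν (Sum.elim P fun i => T (i + 1)) ∧
      -- `Φ_R = S + U`,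
      JumpingPolynomials.valueSemigroup ν R =
        (((⨆ i, JumpingPolynomials.S β i) ⊔ ⨆ i, JumpingPolynomials.U γ i :
          AddSubmonoid ℚ) : Set ℚ) ∧
      -- and the values `β_i` (`i ≥ 0`) and `γ_i` (`i > 0`) generate `Φ_R`
      JumpingPolynomials.valueSemigroup ν R =
        (AddSubmonoid.closure (Set.range β ∪ γ '' {i | 0 < i}) : Set ℚ) := by
  open JumpingPolynomials in
  have hν : ∀ f : R, 0 ≤ ν (algebraMap R K f) := fun f => (hdom f).1
  have hpos : ∀ f ∈ IsLocalRing.maximalIdeal R, 0 < ν (algebraMap R K f) := fun f hf =>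
    (hdom f).2.1 hf
  have hres : ∀ f : R, ∃ c : k, f - algebraMap k R c ∈ IsLocalRing.maximalIdeal R := by
    intro f
    obtain ⟨c, hc⟩ := exists_lt_map_sub hk hzero (hν f)
    refine ⟨c, (hdom _).2.2 ?_⟩
    rwa [map_sub, ← IsScalarTower.algebraMap_apply]
  have hxy : ∀ n, ¬ x ∣ y ^ n := not_dvd_pow hdim hxyz
  have hyx : ∀ n, ¬ y ∣ x ^ n := not_dvd_pow hdim (z := z) (by rw [hxyz, Set.insert_comm])
  have hx : x ≠ 0 := by
    rintro rfl
    exact hyx 1 (by simp)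
  have hy : y ≠ 0 := by
    rintro rfl
    exact hxy 1 (by simp)
  have hval : ∀ f : R, f ≠ 0 → f ∈ ({x, y, z} : Set R) → 0 < val ν f := by
    intro f hf hfm
    have h := hpos f (hxyz ▸ Ideal.subset_span hfm)
    rw [map_eq_val hf] at h
    exact_mod_cast h
  have hxpos := hval x hx (by simp)
  have hypos := hval y hy (by simp)
  refine ⟨exists_isJumpingSequence hk hzero hx hxpos hypos hxy z, fun P T β γ Z h => ?_⟩
  have hprop := fun n => P_properties (k := k) hx hxpos hypos hxy h.P_zero h.P_one h.beta_eq n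
    fun i hi _ => h.P_succ i hi
  have hP : ∀ j, P j ≠ 0 := fun j => ((hprop j).1 j le_rfl).1
  have h0 : β 0 ≠ 0 := ((hprop 0).1 0 le_rfl).2.ne'
  have hgen : IsGeneratingSequence ν (Sum.elim P fun i => T (i + 1)) := by
    intro σ _
    have := h.monomialIdeal_eq hν hk hpos hres hxyz hP h0 σ
    exact congrArg (fun I : Ideal R => (I : Set R)) this
  have hΦ : valueSemigroup ν R =
      (AddSubmonoid.closure (Set.range β ∪ γ '' {i | 0 < i}) : Set ℚ) := by
    rw [valueSemigroup_eq_closure _ hν hgen]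
    congr 2
    ext a
    constructor
    · rintro ⟨v | v, rfl⟩
      · exact Or.inl ⟨v, h.beta_eq v⟩
      · exact Or.inr ⟨v + 1, v.succ_pos, h.gamma_eq _⟩
    · rintro (⟨j, rfl⟩ | ⟨j, hj, rfl⟩)
      · exact ⟨Sum.inl j, (h.beta_eq j).symm⟩
      · obtain ⟨l, rfl⟩ := Nat.exists_eq_add_of_le' (show 1 ≤ j from hj)
        exact ⟨Sum.inr l, (h.gamma_eq _).symm⟩
  exact ⟨hgen, by rw [hΦ, iSup_S_sup_iSup_U], hΦ⟩
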